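/- For functions $r,q:\mathbb{N}\to\mathbb{N}$ and $c,s:\mathbb{N}\to[0,1]$, let $\mathrm{PCP}_{c,s}[r,q]$ be the class of languages $L\subseteq\{0,1\}^*$ that have a polynomial-time non-adaptive verifier $V$ of the following kind. On every input $x$ of length $n$, the verifier tosses at most $r(n)$ coins (their number being computed from $x$ alone), computes from $x$ and the outcome of the coin tosses at most $q(n)$ positions at which it reads bits of a proof $\pi$, and then accepts or rejects depending on $x$, the coin tosses and the bits read. If $x\in L$, then for some proof $\pi$ it accepts with probability at least $c(n)$; if $x\notin L$, then for every proof $\pi$ it accepts with probability at most $s(n)$. The verifier has proof length $\ell(n)$ if on inputs of length $n$ it reads only the first $\ell(n)$ bits of $\pi$. **Theorem.** Let $0<s<c<1$ be constants. There are constants $s'\in(0,1)$ and $C\in\mathbb{N}$, depending only on $c$ and $s$, such that for all $r,q:\mathbb{N}\to\mathbb{N}$, $$\mathrm{PCP}_{c,s}[r,q]\subseteq \mathrm{PCP}_{1,s'}[r,\,q+C\cdot r].$$ Furthermore, for every $\ell:\mathbb{N}\to\mathbb{N}$, if a language has a verifier as in the definition of $\mathrm{PCP}_{c,s}[r,q]$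 with proof length $\ell(n)$, then it has one as in the definition of $\mathrm{PCP}_{1,s'}[r,q+C\cdot r]$ with proof length $\ell(n)+C\cdot 2^{r(n)}$. -/

import Mathlib

/-- A list of bit strings as one string over the alphabet `{0, 1, #}` (with `none` for `#`):
every block is followed by the separator `#`. -/
def encodeBlocks (bs : List (List Bool)) : List (Option Bool) :=
  bs.flatMap fun b => b.map some ++ [none]

/-- `f` is computed by a deterministic (multi-stack) Turing machine in time polynomial in the length
of the encoding `ea a` of its argument `a`; the output is encoded by `eb`. -/
def PolyTime {α β : Type} (ea : α → List (Option Bool)) (eb : β → List (Option Bool))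
    (f : α → β) : Prop :=
  Nonempty (Turing.TM2ComputableInPolyTime ea eb f)

/-- A polynomial-time non-adaptive verifier with oracle access to a proof.
On input `x` it tosses `coins x` coins. From `x` and the outcome `R` of the coin tosses it
computes the list `query x R` of all the positions at which it reads the proof, and then decides
from `x`, `R` and the list `A` of the bits read whether it accepts, which is `decide x R A`. -/
structure Verifier where
  coins : List Bool → ℕ
  query : List Bool → List Bool → List ℕ
  decide : List Bool → List Bool → List Bool → Bool
  /-- The number of coins is computed in unary, so it is polynomially bounded. -/
  coins_polyTime :
    PolyTime (fun x : List Bool => encodeBlocks [x])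
      (fun k : ℕ => encodeBlocks [List.replicate k true]) coins
  /-- The positions are written in binary. -/
  query_polyTime :
    PolyTime (fun p : List Bool × List Bool => encodeBlocks [p.1, p.2])
      (fun l : List ℕ => encodeBlocks (l.map Nat.bits)) (fun p => query p.1 p.2)
  decide_polyTime :
    PolyTime (fun p : List Bool × List Bool × List Bool => encodeBlocks [p.1, p.2.1, p.2.2])
      (fun b : Bool => [some b]) (fun p => decide p.1 p.2.1 p.2.2)

namespace Verifier

/-- `V` accepts the input `x` with the proof `π` when the outcome of its coin tosses is `R`. -/
def Accepts (V : Verifier) (π : ℕ → Bool) (x R : List Bool) : Prop :=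
  V.decide x R ((V.query x R).map π) = true

/-- The probability, over uniform and independent coin tosses, that `V` accepts `x` with
the proof `π`. -/
noncomputable def acceptProb (V : Verifier) (π : ℕ → Bool) (x : List Bool) : ℝ :=
  (Nat.card {R : Fin (V.coins x) → Bool // V.Accepts π x (List.ofFn R)} : ℝ) / 2 ^ V.coins x

/-- `V` is `(r, q)`-restricted: on every input of length `n` it tosses at most `r n` coins and
reads at most `q n` bits of the proof. -/
def Restricted (V : Verifier) (r q : ℕ → ℕ) : Prop :=
  ∀ x : List Bool, V.coins x ≤ r x.length ∧
    ∀ R : Fin (V.coins x) → Bool, (V.query x (List.ofFn R)).length ≤ q x.length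

/-- `V` works with proofs of `ℓ n` bits on inputs of length `n`: it reads none but the first `ℓ n`
bits. -/
def HasProofLength (V : Verifier) (ℓ : ℕ → ℕ) : Prop :=
  ∀ (x : List Bool) (R : Fin (V.coins x) → Bool),
    ∀ i ∈ V.query x (List.ofFn R), i < ℓ x.length

/-- `V` verifies the language `L` with completeness `c` and soundness `s`
(functions of the input length). -/
def Verifies (V : Verifier) (c s : ℕ → ℝ) (L : Language Bool) : Prop :=
  (∀ x ∈ L, ∃ π : ℕ → Bool, c x.length ≤ V.acceptProb π x) ∧
    ∀ x ∉ L, ∀ π : ℕ → Bool, V.acceptProb π x ≤ s x.length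

end Verifier

/-- The class `PCP_{c,s}[r, q]`. -/
def PCP (c s : ℕ → ℝ) (r q : ℕ → ℕ) : Set (Language Bool) :=
  {L | ∃ V : Verifier, V.Restricted r q ∧ V.Verifies c s L}

/-- The languages in `PCP_{c,s}[r, q]` with proofs of `ℓ n` bits on inputs of length `n`. -/
def PCPWithLength (c s : ℕ → ℝ) (r q ℓ : ℕ → ℕ) : Set (Language Bool) :=
  {L | ∃ V : Verifier, V.Restricted r q ∧ V.HasProofLength ℓ ∧ V.Verifies c s L}

/-! Fix a rational threshold `a / q` strictly between `s` and `c`, and let the coin outcomes be the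
leaves of a complete binary tree. In front of the old proof, the new proof stores for every node a
number that claims to be at most the number of accepting leaves below it. The verifier uses its
coins twice: for the old verifier and as the path of a walk from the root to a leaf. It tests that
the root claims at least the fraction `a / q` of all leaves, that a node does not claim more than
its two children together, and that a leaf with claim 1 is accepted by the old verifier. The true
counts pass all tests, whence completeness 1 (`Honest.passes`).

Reading all numbers on the path would cost about `r ^ 2` bits. Instead, a node is tested only along
the run of equal path bits that starts at it: on arrival at height `m` of the run, the verifier
reads the bits of weight `2 ^ m` of that node and of its two children. The difference (children
minus node) is accumulated in Horner form, `D ↦ 2 * D + digit`. Once `D ≤ -2`, the unread bits of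
the children, less than `2 * 2 ^ m` together, cannot repair it; once `D ≥ 1`, it stays so. Hence `D`
may be saturated to `[-2, 1]`. The comparison of the root with the threshold is treated likewise.
This takes six bits per coin and a finite memory (`decide_walk`).

For soundness, a deficit discovered at height `m` is at most `4 * 2 ^ m`, because `D` was at least
`-1` one step earlier (`exists_doomed`), and all `2 ^ m` leaves below reject. The claim of a node at
which a walk fails is below `2 * 2 ^ m`. Induction over the tree charges both amounts to rejecting
leaves: the claim of the root is at most the number of accepting leaves plus `2 + 4 = 6` times the
number of failing walks (`claim_add_le`). If the root claims `a / q` while only a fraction `s`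
accepts, at least a fraction `(a / q - s) / 6` of the walks fails.

Polynomial time is proved for actual machines: small stack programs run before and after the given
machine, on stacks of their own (`PolyTime.wrap`). The position of a tree bit is a self-delimiting
binary word that a finite transducer computes from the path, and the old proof is shifted by a power
of two. -/

open Function Turing

/-! ### Reachability within a time bound -/

/-- `f` leads from `a` to `b` in at most `t` steps. -/
def ReachesIn {σ : Type*} (f : σ → Option σ) (a b : σ) (t : ℕ) : Prop :=
  ∃ n ≤ t, (flip bind f)^[n] (some a) = some b

namespace ReachesIn

variable {σ : Type*} {f : σ → Option σ} {a b c : σ} {s t : ℕ}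

theorem refl (a : σ) : ReachesIn f a a 0 := ⟨0, le_rfl, rfl⟩

theorem mono (h : ReachesIn f a b s) (hst : s ≤ t) : ReachesIn f a b t :=
  let ⟨n, hn, e⟩ := h
  ⟨n, hn.trans hst, e⟩

theorem trans (h₁ : ReachesIn f a b s) (h₂ : ReachesIn f b c t) : ReachesIn f a c (s + t) := by
  obtain ⟨n, hn, e⟩ := h₁
  obtain ⟨m, hm, e'⟩ := h₂
  exact ⟨m + n, by omega, by rw [iterate_add_apply, e, e']⟩

theorem single (h : f a = some b) : ReachesIn f a b 1 :=
  ⟨1, le_rfl, by simpa [flip] using h⟩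

theorem head (h : f a = some b) (h' : ReachesIn f b c t) : ReachesIn f a c (t + 1) := by
  rw [add_comm]; exact (single h).trans h'

end ReachesIn

/-! ### Structured stack programs -/

/-- The local variables of a stack program: a register for the last symbol read, and a finite
memory. -/
abbrev Prog.State (ρ : Type) : Type := Option (Option Bool) × ρ

/-- Structured programs that act on stacks (indexed by `K`) of symbols `0`, `1`, `#`, with a
register and a finite memory `ρ`. -/
inductive Prog (K ρ : Type) : Type
  | pop (k : K)
  | push (k : K) (f : Prog.State ρ → Option (Option Bool))
  | load (f : Prog.State ρ → Prog.State ρ)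
  | seq (p q : Prog K ρ)
  | loop (c : Prog.State ρ → Bool) (p : Prog K ρ)

namespace Prog

variable {K ρ : Type}

infixr:60 " ;; " => Prog.seq

/-- `Runs p v S v' S' t`: the program `p` started in memory `v` with stacks `S` ends in memory `v'`
with stacks `S'` after at most `t` steps. -/
inductive Runs [DecidableEq K] : Prog K ρ → State ρ → (K → List (Option Bool)) →
    State ρ → (K → List (Option Bool)) → ℕ → Prop
  | pop (k v S) : Runs (.pop k) v S ((S k).head?, v.2) (update S k (S k).tail) 1
  | push (k f v S) : Runs (.push k f) v S v (update S k ((f v).toList ++ S k)) 1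
  | load (f v S) : Runs (.load f) v S (f v) S 1
  | seq {p q v S v' S' v'' S'' t t'} : Runs p v S v' S' t → Runs q v' S' v'' S'' t' →
      Runs (.seq p q) v S v'' S'' (t + t')
  | loop_done {c p v S} : c v = false → Runs (.loop c p) v S v S 1
  | loop_step {c p v S v' S' v'' S'' t t'} : c v = true → Runs p v S v' S' t →
      Runs (.loop c p) v' S' v'' S'' t' → Runs (.loop c p) v S v'' S'' (t + t' + 1)
  | mono {p v S v' S' t t'} : Runs p v S v' S' t → t ≤ t' → Runs p v S v' S' t'

/-- The program points of a program. -/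
@[reducible] def Point : Prog K ρ → Type
  | .pop _ => Unit
  | .push _ _ => Unit
  | .load _ => Unit
  | .seq p q => p.Point ⊕ q.Point
  | .loop _ p => Option p.Point

instance Point.fintype : ∀ p : Prog K ρ, Fintype p.Point
  | .pop _ => inferInstanceAs (Fintype Unit)
  | .push _ _ => inferInstanceAs (Fintype Unit)
  | .load _ => inferInstanceAs (Fintype Unit)
  | .seq p q =>
    haveI := Point.fintype p
    haveI := Point.fintype q
    inferInstanceAs (Fintype (p.Point ⊕ q.Point))
  | .loop _ p =>
    haveI := Point.fintype p
    inferInstanceAs (Fintype (Option p.Point))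

/-- The first program point of a program. -/
def entry : ∀ p : Prog K ρ, p.Point
  | .pop _ => ()
  | .push _ _ => ()
  | .load _ => ()
  | .seq p _ => .inl p.entry
  | .loop _ _ => none

/-! ### Compilation of stack programs to machine statements -/

section Compile

variable {K₀ : Type} (Γ : K₀ → Type) (σ₀ Λ : Type)

/-- The alphabets of a machine with stacks of its own next to those of stack programs. -/
@[reducible] def Alphabet (K : Type) : K₀ ⊕ K → Type
  | .inl k => Γ k
  | .inr _ => Option Bool

variable {Γ σ₀ Λ}

/-- The stacks of a machine together with those of a stack program. -/
def join (S : ∀ k, List (Γ k)) (T : K → List (Option Bool)) : ∀ k, List (Alphabet Γ K k)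
  | .inl k => S k
  | .inr k => T k

variable [DecidableEq K₀] [DecidableEq K]

theorem update_join_inl (S : ∀ k, List (Γ k)) (T : K → List (Option Bool)) (k : K₀)
    (l : List (Γ k)) : update (join S T) (.inl k) l = join (update S k l) T := by
  funext i
  rcases i with i | i
  · by_cases h : i = k
    · subst h; exact (update_self _ _ _).trans (update_self i l S).symm
    · exact (update_of_ne (by simpa using h) _ _).trans
        (show S i = update S k l i from (update_of_ne h _ _).symm)
  · exact update_of_ne (by simp) _ _

theorem update_join_inr (S : ∀ k, List (Γ k)) (T : K → List (Option Bool)) (k : K)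
    (l : List (Option Bool)) :
    update (join S T) (.inr k) l = join S (update T k l) := by
  funext i
  rcases i with i | i
  · exact update_of_ne (by simp) _ _
  · by_cases h : i = k
    · subst h; exact (update_self _ _ _).trans (update_self i l T).symm
    · exact (update_of_ne (by simpa using h) _ _).trans
        (show T i = update T k l i from (update_of_ne h _ _).symm)

/-- The statements of a program, when its program points are named by `emb` and it continues at
`exit`. -/
def code : ∀ p : Prog K ρ, (p.Point → Λ) → Λ → p.Point →
    TM2.Stmt (Alphabet Γ K) Λ (σ₀ × State ρ)
  | .pop k, _, exit, _ =>
    .pop (.inr k) (fun v (o : Option (Option Bool)) => (v.1, (o, v.2.2))) (.goto fun _ => exit)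
  | .push k f, _, exit, _ =>
    .branch (fun v => (f v.2).isSome)
      (.push (.inr k) (fun v => ((f v.2).getD none : Option Bool)) (.goto fun _ => exit))
      (.goto fun _ => exit)
  | .load f, _, exit, _ => .load (fun v => (v.1, f v.2)) (.goto fun _ => exit)
  | .seq p q, emb, _, .inl l => code p (fun l => emb (.inl l)) (emb (.inr q.entry)) l
  | .seq _ q, emb, exit, .inr l => code q (fun l => emb (.inr l)) exit l
  | .loop c p, emb, exit, none =>
    .branch (fun v => c v.2) (.goto fun _ => emb (some p.entry)) (.goto fun _ => exit)
  | .loop _ p, emb, _, some l => code p (fun l => emb (some l)) (emb none) l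

/-- Quantifying over the ambient machine `m`, the names `emb` of the program points and the
continuation `exit` lets the induction descend into subprograms, which are embedded in the same
machine with other names. The foreign memory `w` and stacks `S` are never touched. -/
theorem Runs.reachesIn {p : Prog K ρ} {v v' : State ρ} {T T' : K → List (Option Bool)} {t : ℕ}
    (h : Runs p v T v' T' t) :
    ∀ (m : Λ → TM2.Stmt (Alphabet Γ K) Λ (σ₀ × State ρ)) (emb : p.Point → Λ) (exit : Λ)
      (_ : ∀ l, m (emb l) = code p emb exit l) (w : σ₀) (S : ∀ k, List (Γ k)),
      ReachesIn (TM2.step m) ⟨some (emb p.entry), (w, v), join S T⟩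
        ⟨some exit, (w, v'), join S T'⟩ t := by
  induction h with
  | pop k v T =>
    intro m emb exit hm w S
    refine ReachesIn.single ?_
    rw [TM2.step, hm, ← update_join_inr]
    rfl
  | push k f v T =>
    intro m emb exit hm w S
    refine ReachesIn.single ?_
    rw [TM2.step, hm, ← update_join_inr]
    rcases hf : f v with _ | s
    · simp only [code, TM2.stepAux, hf, Option.isSome_none, cond_false, Option.toList_none,
        List.nil_append]
      rw [update_join_inr, update_eq_self]
    · simp only [code, TM2.stepAux, hf, Option.isSome_some, cond_true]
      rfl
  | load f v T =>
    intro m emb exit hm w S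
    refine ReachesIn.single ?_
    rw [TM2.step, hm]
    rfl
  | @seq p q v T v' T' v'' T'' t t' _ _ ih₁ ih₂ =>
    intro m emb exit hm w S
    exact (ih₁ m (fun l => emb (.inl l)) _ (fun l => hm (.inl l)) w S).trans
      (ih₂ m (fun l => emb (.inr l)) exit (fun l => hm (.inr l)) w S)
  | @loop_done c p v T hc =>
    intro m emb exit hm w S
    refine ReachesIn.single ?_
    rw [TM2.step, hm]
    simp [entry, code, TM2.stepAux, hc]
  | @loop_step c p v T v' T' v'' T'' t t' hc _ _ ih₁ ih₂ =>
    intro m emb exit hm w S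
    refine ReachesIn.head (b := ⟨some (emb (some p.entry)), (w, v), join S T⟩) ?_ ?_
    · rw [TM2.step, hm]
      simp [entry, code, TM2.stepAux, hc]
    · exact (ih₁ m (fun l => emb (some l)) (emb none) (fun l => hm (some l)) w S).trans
        (ih₂ m emb exit hm w S)
  | mono _ hle ih =>
    intro m emb exit hm w S
    exact (ih m emb exit hm w S).mono hle

end Compile

end Prog

/-! ### Running a program, a machine and another program in succession -/

namespace Turing.TM2.Stmt

/-- An upper bound for the number of symbols a statement pushes. -/
def pushes {K : Type} {Γ : K → Type} {Λ σ : Type} : Stmt Γ Λ σ → ℕ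
  | push _ _ q => q.pushes + 1
  | peek _ _ q => q.pushes
  | pop _ _ q => q.pushes
  | load _ q => q.pushes
  | branch _ q₁ q₂ => q₁.pushes + q₂.pushes
  | goto _ => 0
  | halt => 0

theorem length_stepAux_le {K : Type} [DecidableEq K] {Γ : K → Type} {Λ σ : Type}
    (q : Stmt Γ Λ σ) (v : σ) (S : ∀ k, List (Γ k)) (k : K) :
    ((stepAux q v S).stk k).length ≤ (S k).length + q.pushes := by
  induction q generalizing v S with
  | push k' f q ih =>
    refine (ih _ _).trans ?_
    by_cases h : k = k'
    · subst h; simp [pushes]; try omega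
    · simp [pushes, h]
  | peek k' f q ih => exact ih _ _
  | pop k' f q ih =>
    refine (ih _ _).trans ?_
    by_cases h : k = k'
    · subst h; simp [pushes]
    · simp [pushes, h]
  | load f q ih => exact ih _ _
  | branch f q₁ q₂ ih₁ ih₂ =>
    simp only [stepAux, pushes]
    cases f v
    · exact (ih₂ _ _).trans (by simp)
    · exact (ih₁ _ _).trans (by simp)
  | goto f => simp [pushes]
  | halt => simp [pushes]

/-- The statement of a machine, run with the stacks and the memory of a stack program at its side;
instead of halting it continues at `exit`. -/
def extend {K₀ : Type} {Γ : K₀ → Type} {Λ₀ σ₀ : Type} (K ρ : Type) {Λ : Type} (emb : Λ₀ → Λ)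
    (exit : Λ) : Stmt Γ Λ₀ σ₀ → Stmt (Prog.Alphabet Γ K) Λ (σ₀ × Prog.State ρ)
  | push k f q => push (.inl k) (fun v => f v.1) (extend K ρ emb exit q)
  | peek k f q => peek (.inl k) (fun v o => (f v.1 o, v.2)) (extend K ρ emb exit q)
  | pop k f q => pop (.inl k) (fun v o => (f v.1 o, v.2)) (extend K ρ emb exit q)
  | load f q => load (fun v => (f v.1, v.2)) (extend K ρ emb exit q)
  | branch f q₁ q₂ => branch (fun v => f v.1) (extend K ρ emb exit q₁) (extend K ρ emb exit q₂)
  | goto f => goto fun v => emb (f v.1)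
  | halt => goto fun _ => exit

theorem stepAux_extend {K₀ K : Type} [DecidableEq K₀] [DecidableEq K] {Γ : K₀ → Type}
    {Λ₀ σ₀ ρ Λ : Type} (emb : Λ₀ → Λ) (exit : Λ) (q : Stmt Γ Λ₀ σ₀) (v : σ₀) (w : Prog.State ρ)
    (S : ∀ k, List (Γ k)) (T : K → List (Option Bool)) :
    stepAux (extend K ρ emb exit q) (v, w) (Prog.join S T) =
      ⟨some ((stepAux q v S).l.elim exit emb), ((stepAux q v S).var, w),
        Prog.join (stepAux q v S).stk T⟩ := by
  induction q generalizing v S with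
  | push k f q ih =>
    refine Eq.trans ?_ (ih _ _)
    rw [← Prog.update_join_inl]
    rfl
  | peek k f q ih =>
    simp only [extend, stepAux]
    exact ih _ _
  | pop k f q ih =>
    refine Eq.trans ?_ (ih _ _)
    rw [← Prog.update_join_inl]
    rfl
  | load f q ih =>
    simp only [extend, stepAux]
    exact ih _ _
  | branch f q₁ q₂ ih₁ ih₂ =>
    simp only [extend, stepAux]
    cases f v
    · exact ih₂ _ _
    · exact ih₁ _ _
  | goto f => simp [extend, stepAux]
  | halt => simp [extend, stepAux]

end Turing.TM2.Stmt

/-- The phases of a machine that runs a program, another machine and another program. -/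
inductive Phase (P L Q : Type) : Type
  | pre (l : P)
  | feed
  | run (l : L)
  | fetch
  | post (l : Q)
  | finish
  deriving Fintype

namespace Turing.FinTM2

open Prog

variable (M : FinTM2) (e₀ : M.Γ M.k₀ ≃ Option Bool) (e₁ : M.Γ M.k₁ ≃ Option Bool) {K ρ : Type}
  (i x o : K) (v₀ : State ρ) (p q : Prog K ρ)

/-- The statements of the machine that runs the program `p`, moves the stack `x` to the input of
`M`, runs `M`, moves the output of `M` back to `x` and runs `q`. -/
def wrapStmt : Phase p.Point M.Λ q.Point →
    TM2.Stmt (Alphabet M.Γ K) (Phase p.Point M.Λ q.Point) (M.σ × State ρ)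
  | .pre l => code p .pre .feed l
  | .feed =>
    .pop (.inr x) (fun v (s : Option (Option Bool)) => (v.1, (s, v.2.2)))
      (.branch (fun v => v.2.1.isSome)
        (.push (.inl M.k₀) (fun v => e₀.symm (v.2.1.getD none)) (.goto fun _ => .feed))
        (.goto fun _ => .run M.main))
  | .run l => (M.m l).extend K ρ .run .fetch
  | .fetch =>
    .pop (.inl M.k₁) (fun v (s : Option (M.Γ M.k₁)) => (v.1, (s.map e₁, v.2.2)))
      (.branch (fun v => v.2.1.isSome)
        (.push (.inr x) (fun v => (v.2.1.getD none : Option Bool)) (.goto fun _ => .fetch))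
        (.goto fun _ => .post q.entry))
  | .post l => code q .post .finish l
  | .finish => .halt

variable [DecidableEq K]

/-- The machine with the statements `FinTM2.wrapStmt`. -/
def wrap [Fintype K] [Fintype ρ] : FinTM2 where
  K := M.K ⊕ K
  kFin := haveI := M.kFin; inferInstance
  k₀ := .inr i
  k₁ := .inr o
  Γ := Alphabet M.Γ K
  Λ := Phase p.Point M.Λ q.Point
  main := .pre p.entry
  ΛFin := haveI := M.ΛFin; inferInstance
  σ := M.σ × State ρ
  initialState := (M.initialState, v₀)
  σFin := haveI := M.σFin; inferInstance
  Γk₀Fin := inferInstanceAs (Fintype (Option Bool))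
  m := wrapStmt M e₀ e₁ x p q

/-- Moving a stack symbol by symbol reverses it. This is why the surrounding programs leave and find
their data on `x` in reverse. -/
theorem reachesIn_feed (w : M.σ) (m : ρ) (l : List (Option Bool)) :
    ∀ (r : Option (Option Bool)) (S : ∀ k, List (M.Γ k)) (T : K → List (Option Bool)), T x = l →
      ReachesIn (TM2.step (M.wrapStmt e₀ e₁ x p q))
        ⟨some .feed, (w, (r, m)), join S T⟩
        ⟨some (.run M.main), (w, (none, m)),
          join (update S M.k₀ (l.reverse.map e₀.symm ++ S M.k₀)) (update T x [])⟩
        (l.length + 1) := by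
  induction l with
  | nil =>
    intro r S T hT
    refine ReachesIn.single ?_
    have h1 : update S M.k₀ (S M.k₀) = S := update_eq_self _ _
    have h2 : update T x [] = T := by rw [← hT, update_eq_self]
    simp only [List.reverse_nil, List.map_nil, List.nil_append, h1, h2]
    simp only [TM2.step, wrapStmt, TM2.stepAux]
    rw [update_join_inr]
    simp [join, hT, h2]
  | cons s l ih =>
    intro r S T hT
    refine ReachesIn.head (b := ⟨some .feed, (w, (some s, m)),
      join (update S M.k₀ (e₀.symm s :: S M.k₀)) (update T x l)⟩) ?_ ?_
    · simp only [TM2.step, wrapStmt, TM2.stepAux]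
      rw [update_join_inr, update_join_inl]
      simp [join, hT]
    · refine Eq.mp ?_ (ih (some s) (update S M.k₀ (e₀.symm s :: S M.k₀)) (update T x l)
        (update_self _ _ _))
      simp

theorem reachesIn_fetch (w : M.σ) (m : ρ) (l : List (M.Γ M.k₁)) :
    ∀ (r : Option (Option Bool)) (S : ∀ k, List (M.Γ k)) (T : K → List (Option Bool)),
      S M.k₁ = l →
      ReachesIn (TM2.step (M.wrapStmt e₀ e₁ x p q))
        ⟨some .fetch, (w, (r, m)), join S T⟩
        ⟨some (.post q.entry), (w, (none, m)),
          join (update S M.k₁ []) (update T x (l.reverse.map e₁ ++ T x))⟩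
        (l.length + 1) := by
  induction l with
  | nil =>
    intro r S T hS
    refine ReachesIn.single ?_
    have h1 : update T x (T x) = T := update_eq_self _ _
    have h2 : update S M.k₁ [] = S := by rw [← hS, update_eq_self]
    simp only [List.reverse_nil, List.map_nil, List.nil_append, h1, h2]
    simp only [TM2.step, wrapStmt, TM2.stepAux]
    rw [update_join_inl]
    simp [join, hS, h2]
  | cons s l ih =>
    intro r S T hS
    refine ReachesIn.head (b := ⟨some .fetch, (w, (some (e₁ s), m)),
      join (update S M.k₁ l) (update T x (e₁ s :: T x))⟩) ?_ ?_
    · simp only [TM2.step, wrapStmt, TM2.stepAux]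
      rw [update_join_inl, update_join_inr]
      simp [join, hS]
    · refine Eq.mp ?_ (ih (some (e₁ s)) (update S M.k₁ l) (update T x (e₁ s :: T x))
        (update_self _ _ _))
      simp

/-- The halted configurations of `M` (label `none`) correspond to the phase `fetch`, so that the
simulation is step by step and costs no extra time. -/
theorem reachesIn_run {c c' : M.Cfg} {t : ℕ} (h : ReachesIn M.step c c' t) (w : State ρ)
    (T : K → List (Option Bool)) :
    ReachesIn (TM2.step (M.wrapStmt e₀ e₁ x p q))
      ⟨some (c.l.elim .fetch .run), (c.var, w), join c.stk T⟩
      ⟨some (c'.l.elim .fetch .run), (c'.var, w), join c'.stk T⟩ t := by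
  obtain ⟨n, hn, e⟩ := h
  refine ReachesIn.mono ?_ hn
  clear hn
  induction n generalizing c with
  | zero =>
    obtain rfl : c = c' := by simpa using e
    exact ReachesIn.refl _
  | succ n ih =>
    obtain ⟨l, v, S⟩ := c
    rcases l with _ | l
    · rw [iterate_succ_apply] at e
      have : ∀ n, (flip bind M.step)^[n] none = none := by
        intro n
        induction n with
        | zero => rfl
        | succ n ih => rw [iterate_succ_apply]; exact ih
      have e' : (flip bind M.step)^[n] none = some c' := e
      rw [this] at e'
      cases e'
    · refine ReachesIn.head ?_ (ih (c := TM2.stepAux (M.m l) v S) ?_)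
      · exact congrArg some (TM2.Stmt.stepAux_extend _ _ (M.m l) v w S T)
      · exact e

/-- The output stack grows by a bounded number of symbols per step. -/
theorem exists_length_le : ∃ B : ℕ, ∀ {c c' : M.Cfg} {t : ℕ}, ReachesIn M.step c c' t →
    ∀ k, (c'.stk k).length ≤ (c.stk k).length + B * t := by
  have := M.ΛFin
  refine ⟨Finset.univ.sup fun l => (M.m l).pushes, ?_⟩
  intro c c' t h k
  obtain ⟨n, hn, e⟩ := h
  suffices h : (c'.stk k).length ≤
      (c.stk k).length + (Finset.univ.sup fun l => (M.m l).pushes) * n from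
    h.trans (by gcongr)
  clear hn
  induction n generalizing c' with
  | zero =>
    obtain rfl : c = c' := by simpa using e
    simp
  | succ n ih =>
    rw [iterate_succ_apply'] at e
    rcases h : (flip bind M.step)^[n] (some c) with _ | c₁
    · rw [h] at e; cases e
    · rw [h] at e
      replace e : M.step c₁ = some c' := e
      obtain ⟨l, v, S⟩ := c₁
      rcases l with _ | l
      · cases e
      · obtain rfl : TM2.stepAux (M.m l) v S = c' := Option.some.inj e
        have h₁ := ih h
        have h₂ := TM2.Stmt.length_stepAux_le (M.m l) v S k
        have h₃ := Finset.le_sup (f := fun l => (M.m l).pushes) (Finset.mem_univ l)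
        simp only at h₁ h₃
        rw [mul_add]
        omega

end Turing.FinTM2

namespace Turing

theorem initList_eq (M : FinTM2) (l : List (M.Γ M.k₀)) :
    initList M l = ⟨some M.main, M.initialState, update (fun _ => []) M.k₀ l⟩ := by
  unfold initList
  congr 1
  funext k
  by_cases h : k = M.k₀
  · subst h; simp
  · simp [h]

theorem haltList_eq (M : FinTM2) (l : List (M.Γ M.k₁)) :
    haltList M l = ⟨none, M.initialState, update (fun _ => []) M.k₁ l⟩ := by
  unfold haltList
  congr 1
  funext k
  by_cases h : k = M.k₁
  · subst h; simp
  · simp [h]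

end Turing

theorem Polynomial.eval_le_eval_of_le (P : Polynomial ℕ) {m n : ℕ} (h : m ≤ n) :
    P.eval m ≤ P.eval n := by
  induction P using Polynomial.induction_on' with
  | add p q hp hq => simp only [eval_add]; exact add_le_add hp hq
  | monomial k a => simp only [eval_monomial]; gcongr

theorem Turing.FinTM2.initList_wrap (M : FinTM2) (e₀ : M.Γ M.k₀ ≃ Option Bool)
    (e₁ : M.Γ M.k₁ ≃ Option Bool) {K ρ : Type} [DecidableEq K] [Fintype K] [Fintype ρ] (i x o : K)
    (v₀ : Prog.State ρ) (p q : Prog K ρ) (l : List (Option Bool)) :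
    initList (M.wrap e₀ e₁ i x o v₀ p q) l = ⟨some (.pre p.entry), (M.initialState, v₀),
      Prog.join (fun _ => []) (update (fun _ => []) i l)⟩ := by
  refine (initList_eq _ _).trans ?_
  rw [← Prog.update_join_inr]
  congr 2
  funext k
  rcases k with k | k <;> rfl

theorem Turing.FinTM2.haltList_wrap (M : FinTM2) (e₀ : M.Γ M.k₀ ≃ Option Bool)
    (e₁ : M.Γ M.k₁ ≃ Option Bool) {K ρ : Type} [DecidableEq K] [Fintype K] [Fintype ρ] (i x o : K)
    (v₀ : Prog.State ρ) (p q : Prog K ρ) (l : List (Option Bool)) :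
    haltList (M.wrap e₀ e₁ i x o v₀ p q) l = ⟨none, (M.initialState, v₀),
      Prog.join (fun _ => []) (update (fun _ => []) o l)⟩ := by
  refine (haltList_eq _ _).trans ?_
  rw [← Prog.update_join_inr]
  congr 2
  funext k
  rcases k with k | k <;> rfl

open Prog Polynomial in
/-- Let `f` be computable in polynomial time. Then so is a function that is computed in polynomial
time by a program that prepares an argument of `f` on the stack `x` (in reverse) and another program
that finishes from the value of `f` on the stack `x` (in reverse). -/
theorem PolyTime.wrap {α β α' β' : Type} {ea : α → List (Option Bool)}
    {eb : β → List (Option Bool)} {ea' : α' → List (Option Bool)} {eb' : β' → List (Option Bool)}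
    {f : α → β} (hf : PolyTime ea eb f) {g : α' → β'} {K ρ : Type} [DecidableEq K] [Fintype K]
    [Fintype ρ] (i x o : K) (v₀ : State ρ) (p q : Prog K ρ) (u : α' → α) (mid : α' → ρ)
    (side : α' → K → List (Option Bool)) (c d : ℕ)
    (hlen : ∀ a, (ea (u a)).length ≤ (ea' a).length)
    (hp : ∀ a, ∃ r, Runs p v₀ (update (fun _ => []) i (ea' a)) (r, mid a)
      (update (side a) x (ea (u a)).reverse) (c * ((ea' a).length + 1) ^ d))
    (hq : ∀ a, Runs q (none, mid a) (update (side a) x (eb (f (u a))).reverse) v₀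
      (update (fun _ => []) o (eb' (g a)))
      (c * ((ea' a).length + (eb (f (u a))).length + 1) ^ d)) :
    PolyTime ea' eb' g := by
  obtain ⟨⟨⟨M, e₀, e₁⟩, P, hM⟩⟩ := hf
  dsimp only at hM
  obtain ⟨B, hB⟩ := M.exists_length_le
  set W := M.wrap e₀ e₁ i x o v₀ p q with hW
  -- The summands are the times of the phases: the program `p`, feeding, the run of `M`, fetching,
  -- the program `q`, and the halting step. The length of the output of `M` is estimated by `X + C B
  -- * P`.
  set Q : ℕ[X] := C c * (X + 1) ^ d + ((X + 1) + (P + ((X + C B * P + 1) +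
    (C c * (X + (X + C B * P) + 1) ^ d + 1)))) with hQ
  suffices h : ∀ a, ReachesIn W.step (initList W (ea' a)) (haltList W (eb' (g a)))
      (Q.eval (ea' a).length) by
    refine ⟨⟨⟨W, Equiv.refl _, Equiv.refl _⟩, Q, fun a => ?_⟩⟩
    have key : ∀ l l' : List (Option Bool), l = ea' a → l' = eb' (g a) →
        Nonempty (TM2OutputsInTime W l (some l') (Q.eval (ea' a).length)) := by
      rintro _ _ rfl rfl
      obtain ⟨n, hn, e⟩ := h a
      exact ⟨⟨⟨n, e⟩, hn⟩⟩
    exact Classical.choice (key _ _ (List.map_id _) (List.map_id _))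
  intro a
  obtain ⟨r, hp⟩ := hp a
  have hrun : ReachesIn M.step (initList M ((ea (u a)).map e₀.symm))
      (haltList M ((eb (f (u a))).map e₁.symm)) (P.eval (ea (u a)).length) := by
    obtain ⟨⟨n, e⟩, hn⟩ := hM (u a)
    exact ⟨n, hn, e⟩
  have hPle := P.eval_le_eval_of_le (hlen a)
  have hout : (eb (f (u a))).length ≤ (ea' a).length + B * P.eval (ea' a).length := by
    have := hB hrun M.k₁
    rw [initList_eq, haltList_eq] at this
    simp only [update_self, List.length_map] at this
    refine this.trans (add_le_add ?_ (by gcongr))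
    -- The input and output stacks of `M` may coincide; then the output stack is not empty at the
    -- start, which accounts for the summand `(ea' a).length`.
    by_cases h : M.k₁ = M.k₀
    · have e' : ∀ (k : M.K) (h : k = M.k₀) (l : List (M.Γ M.k₀)),
          ((Function.update (fun _ => []) M.k₀ l : ∀ k, List (M.Γ k)) k).length = l.length := by
        rintro k rfl l; simp
      rw [e' _ h]
      simpa using hlen a
    · simp [h]
  have s₁ := hp.reachesIn (M.wrapStmt e₀ e₁ x p q) .pre .feed (fun _ => rfl) M.initialState
    (fun _ => [])
  have s₂ := M.reachesIn_feed e₀ e₁ x p q M.initialState (mid a) _ r (fun _ => []) _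
    (update_self x (ea (u a)).reverse (side a))
  have s₃ := M.reachesIn_run e₀ e₁ x p q hrun (none, mid a)
    (update (update (side a) x (ea (u a)).reverse) x [])
  rw [initList_eq, haltList_eq] at s₃
  have s₄ := M.reachesIn_fetch e₀ e₁ x p q M.initialState (mid a) _ none
    (update (fun _ => []) M.k₁ ((eb (f (u a))).map e₁.symm))
    (update (update (side a) x (ea (u a)).reverse) x []) (update_self _ _ _)
  have s₅ := (hq a).reachesIn (M.wrapStmt e₀ e₁ x p q) .post .finish (fun _ => rfl) M.initialState
    (fun _ => [])
  have s₆ : ReachesIn (TM2.step (M.wrapStmt e₀ e₁ x p q))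
      ⟨some .finish, (M.initialState, v₀), join (fun _ => []) (Function.update (fun _ => []) o
        (eb' (g a)))⟩
      ⟨none, (M.initialState, v₀), join (fun _ => []) (Function.update (fun _ => []) o
        (eb' (g a)))⟩ 1 := ReachesIn.single rfl
  have e₂ : Function.update (fun _ => []) M.k₀
      (List.map e₀.symm (ea (u a)).reverse.reverse ++ []) =
        (Function.update (fun _ => []) M.k₀ ((ea (u a)).map e₀.symm) :
          ∀ k, List (M.Γ k)) := by simp
  have e₄ : Function.update (Function.update (fun _ => []) M.k₁ ((eb (f (u a))).map e₁.symm))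
      M.k₁ [] = (fun _ => [] : ∀ k, List (M.Γ k)) := by simp
  have e₅ : Function.update (Function.update (Function.update (side a) x (ea (u a)).reverse) x [])
      x (((eb (f (u a))).map e₁.symm).reverse.map e₁ ++
        Function.update (Function.update (side a) x (ea (u a)).reverse) x [] x) =
      Function.update (side a) x (eb (f (u a))).reverse := by
    simp [← List.map_reverse, Function.comp_def]
  rw [e₂] at s₂
  rw [e₄, e₅] at s₄
  have s := s₁.trans (s₂.trans (s₃.trans (s₄.trans (s₅.trans s₆))))
  have s' : ReachesIn W.step (initList W (ea' a)) (haltList W (eb' (g a))) _ :=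
    (M.initList_wrap e₀ e₁ i x o v₀ p q (ea' a)).symm ▸
      (M.haltList_wrap e₀ e₁ i x o v₀ p q (eb' (g a))).symm ▸ s
  refine s'.mono ?_
  simp only [hQ, eval_add, eval_mul, eval_pow, eval_C, eval_X, eval_one, List.length_reverse,
    List.length_map]
  have := hlen a
  have h₅ : c * ((ea' a).length + (eb (f (u a))).length + 1) ^ d ≤
      c * ((ea' a).length + ((ea' a).length + B * P.eval (ea' a).length) + 1) ^ d := by gcongr
  omega

/-! ### Counting words -/

/-- The number of words of length `h` that satisfy `P`. -/
def countWords : (List Bool → Bool) → ℕ → ℕ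
  | P, 0 => (P []).toNat
  | P, h + 1 => countWords (fun w => P (true :: w)) h + countWords (fun w => P (false :: w)) h

namespace countWords

/-- With `c` the current bit of a run, this separates the words that continue the run from those
that start a new one. -/
theorem succ (P : List Bool → Bool) (h : ℕ) (c : Bool) : countWords P (h + 1) =
    countWords (fun w => P (c :: w)) h + countWords (fun w => P ((!c) :: w)) h := by
  cases c
  · exact add_comm _ _
  · rfl

theorem le_pow (P : List Bool → Bool) (h : ℕ) : countWords P h ≤ 2 ^ h := by
  induction h generalizing P with
  | zero => simpa [countWords] using Bool.toNat_le _
  | succ h ih =>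
    have h₁ := ih fun w => P (true :: w)
    have h₂ := ih fun w => P (false :: w)
    rw [countWords, pow_succ]
    omega

theorem mono {P Q : List Bool → Bool} {h : ℕ} (hPQ : ∀ w, w.length = h → P w → Q w) :
    countWords P h ≤ countWords Q h := by
  induction h generalizing P Q with
  | zero =>
    have := hPQ [] rfl
    rw [countWords, countWords]
    cases h₁ : P [] <;> cases h₂ : Q [] <;> simp_all
  | succ h ih =>
    exact add_le_add (ih fun w hw => hPQ _ (by simp [hw])) (ih fun w hw => hPQ _ (by simp [hw]))

theorem eq_zero {P : List Bool → Bool} {h : ℕ} (hP : ∀ w, w.length = h → P w = false) :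
    countWords P h = 0 := by
  have : ∀ h, countWords (fun _ => false) h = 0 := by
    intro h
    induction h with
    | zero => rfl
    | succ h ih => simp [countWords, ih]
  have h' := mono (P := P) (Q := fun _ => false) (h := h) fun w hw hw' => by simp_all
  rw [this] at h'
  omega

theorem eq_pow {P : List Bool → Bool} {h : ℕ} (hP : ∀ w, w.length = h → P w = true) :
    countWords P h = 2 ^ h := by
  induction h generalizing P with
  | zero => simp [countWords, hP]
  | succ h ih =>
    rw [countWords, ih fun w hw => hP _ (by simp [hw]), ih fun w hw => hP _ (by simp [hw])]
    ring

theorem card_eq (P : List Bool → Prop) [DecidablePred P] (h : ℕ) :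
    Nat.card {R : Fin h → Bool // P (List.ofFn R)} = countWords (fun w => decide (P w)) h := by
  classical
  induction h generalizing P with
  | zero =>
    rw [Nat.card_eq_fintype_card, Fintype.card_subtype, countWords]
    by_cases hP : P [] <;> simp [hP, Finset.filter_true_of_mem, Finset.filter_false_of_mem]
  | succ h ih =>
    let e : {R : Fin (h + 1) → Bool // P (List.ofFn R)} ≃
        {R : Fin h → Bool // P (true :: List.ofFn R)} ⊕
        {R : Fin h → Bool // P (false :: List.ofFn R)} :=
      { toFun := fun R => if hb : R.1 0 = true
          then .inl ⟨fun i => R.1 i.succ, by have := R.2; rwa [List.ofFn_succ, hb] at this⟩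
          else .inr ⟨fun i => R.1 i.succ, by
            have := R.2; rwa [List.ofFn_succ, Bool.eq_false_of_not_eq_true hb] at this⟩
        invFun := fun R => match R with
          | .inl R => ⟨Fin.cons true R.1, by simpa [List.ofFn_succ] using R.2⟩
          | .inr R => ⟨Fin.cons false R.1, by simpa [List.ofFn_succ] using R.2⟩
        left_inv := by
          rintro ⟨R, hR⟩
          by_cases hb : R 0 = true
          · simp only [hb, dite_true, Subtype.mk.injEq]
            rw [← hb]; exact Fin.cons_self_tail R
          · have hb' := Bool.eq_false_of_not_eq_true hb
            simp only [hb']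
            exact Subtype.ext
              ((congrArg (fun b => Fin.cons b _) hb'.symm).trans (Fin.cons_self_tail R))
        right_inv := by
          rintro (⟨R, hR⟩ | ⟨R, hR⟩) <;> simp }
    rw [Nat.card_congr e, Nat.card_sum, ih (fun w => P (true :: w)), ih (fun w => P (false :: w)),
      countWords]

end countWords

/-! ### The tree of counts

The coin strings of length `r` are the leaves of the complete binary tree of height `r`. A node is
the list of the bits on the way to it from the root, the last bit first. For a node `S` of height
`m + j`, the proof contains a bit `β m j S` of weight `2 ^ m`. The bits of a node `S` of height `h`
form the number `claim β S h`, which claims to be at most the number of accepting leaves below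
`S`. -/

namespace CountTree

variable (β : ℕ → ℕ → List Bool → Bool)

/-- The number formed by the `m` bits of lowest weight of the node `S` of height `m + j - 1`. -/
def lowBits (S : List Bool) : ℕ → ℕ → ℤ
  | _, 0 => 0
  | j, m + 1 => (β m j S).toNat * 2 ^ m + lowBits S (j + 1) m

/-- The number formed by all the bits of the node `S` of height `h`. -/
def claim (S : List Bool) (h : ℕ) : ℤ := lowBits β S 0 (h + 1)

/-- The contribution of the next bits to the difference of the sum of the claims of the children
of `S` and the claim of `S`. -/
def digit (m t : ℕ) (S : List Bool) (c : Bool) : ℤ :=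
  (β m t (c :: S)).toNat + (β m t ((!c) :: S)).toNat - (β m (t + 1) S).toNat

/-- The part of that difference which stems from the `h` lowest bits. -/
def tail (S : List Bool) (c : Bool) (t h : ℕ) : ℤ :=
  lowBits β (c :: S) t h + lowBits β ((!c) :: S) t h - lowBits β S (t + 1) h

/-- The walk from the node `replicate t c ++ S` to the leaf at the end of the path `w` finds no
error; here `D` is the difference for the node `S`, as far as its bits have been read. A run of
equal bits on the way is used to check the node at which it starts. -/
def passes (ver : List Bool → Bool) : List Bool → Bool → ℕ → ℤ → List Bool → Bool
  | S, c, t, D, [] => decide (0 ≤ D) &&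
      (!β 0 0 (List.replicate t c ++ S) || ver (List.replicate t c ++ S))
  | S, c, t, D, b :: w => decide (-1 ≤ D) &&
      if b = c then passes ver S c (t + 1) (2 * D + digit β w.length t S c) w
      else passes ver (List.replicate t c ++ S) b 1
        (2 * -(β (w.length + 1) 0 (List.replicate t c ++ S)).toNat +
          digit β w.length 0 (List.replicate t c ++ S) b) w

/-- The walk from the node `replicate t c ++ S` of height `h` fails after `k` more bits `c`. -/
def Doomed : List Bool → Bool → ℕ → ℤ → ℕ → ℕ → Prop
  | _, _, _, D, 0, h => D ≤ -2 ∨ h = 0 ∧ D < 0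
  | _, _, _, _, _ + 1, 0 => False
  | S, c, t, D, k + 1, h + 1 => Doomed S c (t + 1) (2 * D + digit β h t S c) k h

variable {β}

theorem toNat_cast_nonneg (b : Bool) : (0 : ℤ) ≤ b.toNat := by positivity

theorem toNat_cast_le (b : Bool) : (b.toNat : ℤ) ≤ 1 := by
  cases b <;> simp

theorem lowBits_nonneg (S : List Bool) (j m : ℕ) : 0 ≤ lowBits β S j m := by
  induction m generalizing j with
  | zero => exact le_rfl
  | succ m ih =>
    rw [lowBits]
    have := ih (j + 1)
    positivity

theorem lowBits_lt (S : List Bool) (j m : ℕ) : lowBits β S j m < 2 ^ m := by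
  induction m generalizing j with
  | zero => simp [lowBits]
  | succ m ih =>
    rw [lowBits, pow_succ]
    have := ih (j + 1)
    cases β m j S <;> simp <;> linarith [pow_pos (two_pos : (0 : ℤ) < 2) m]

theorem tail_succ (S : List Bool) (c : Bool) (t h : ℕ) :
    tail β S c t (h + 1) = digit β h t S c * 2 ^ h + tail β S c (t + 1) h := by
  simp only [tail, lowBits, digit]
  ring

/-- The claim of `S` has one bit more than those of its children. This top bit has no counterpart,
so it enters the Horner scheme alone, as the initial value `-(β (h + 1) 0 S).toNat` of `D` for a run
that starts at `S`. -/
theorem claim_add_claim_sub (S : List Bool) (c : Bool) (h : ℕ) :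
    claim β (c :: S) h + claim β ((!c) :: S) h - claim β S (h + 1) =
      (2 * -(β (h + 1) 0 S).toNat + digit β h 0 S c) * 2 ^ h + tail β S c 1 h := by
  have : claim β (c :: S) h + claim β ((!c) :: S) h - claim β S (h + 1) =
      -(β (h + 1) 0 S).toNat * 2 ^ (h + 1) + tail β S c 0 (h + 1) := by
    rw [claim, claim, claim, lowBits.eq_2 β S 0, tail]
    ring
  rw [this, tail_succ]
  ring

theorem le_digit (m t : ℕ) (S : List Bool) (c : Bool) : -1 ≤ digit β m t S c := by
  have := toNat_cast_nonneg (β m t (c :: S))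
  have := toNat_cast_nonneg (β m t ((!c) :: S))
  have := toNat_cast_le (β m (t + 1) S)
  rw [digit]
  linarith

/-- The bound `-3 ≤ D` persists while `-1 ≤ D`, since a digit is at least `-1`. At the first moment
with `D ≤ -2`, the unread bits lower the difference by less than another `2 ^ (h - k)`, so the
deficit is at most `4 * 2 ^ (h - k)`: it is proportional to the number of leaves that reject because
of it. If that moment never comes, the last value of `D` is the exact difference, and its sign is
tested at the leaf. -/
theorem exists_doomed (S : List Bool) (c : Bool) (t h : ℕ) (D : ℤ) (hD : -3 ≤ D) :
    0 ≤ D * 2 ^ h + tail β S c t h ∨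
      ∃ k ≤ h, Doomed β S c t D k h ∧ -(4 * 2 ^ (h - k)) ≤ D * 2 ^ h + tail β S c t h := by
  induction h generalizing t D with
  | zero =>
    have : tail β S c t 0 = 0 := by simp [tail, lowBits]
    rw [this]
    rcases le_or_gt 0 D with h | h
    · left; simpa
    · right; refine ⟨0, le_rfl, Or.inr ⟨rfl, h⟩, ?_⟩
      simp; linarith
  | succ h ih =>
    rcases le_or_gt D (-2) with h' | h'
    · right
      refine ⟨0, Nat.zero_le _, Or.inl h', ?_⟩
      have h₁ := lowBits_nonneg (β := β) (c :: S) t (h + 1)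
      have h₂ := lowBits_nonneg (β := β) ((!c) :: S) t (h + 1)
      have h₃ := lowBits_lt (β := β) S (t + 1) (h + 1)
      rw [tail, Nat.sub_zero]
      nlinarith [pow_pos (two_pos : (0 : ℤ) < 2) (h + 1)]
    · have hd := le_digit (β := β) h t S c
      have e : D * 2 ^ (h + 1) + tail β S c t (h + 1) =
          (2 * D + digit β h t S c) * 2 ^ h + tail β S c (t + 1) h := by
        rw [tail_succ]; ring
      rw [e]
      rcases ih (t + 1) (2 * D + digit β h t S c) (by linarith) with h₀ | ⟨k, hk, h₁, h₂⟩
      · exact Or.inl h₀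
      · refine Or.inr ⟨k + 1, by omega, h₁, ?_⟩
        rwa [Nat.add_sub_add_right]

/-- The claim of a node is at most the number of accepting leaves below it, up to a multiple of
the number of leaves below it at which an error is found. -/
theorem claim_add_le (ver : List Bool → Bool) (S : List Bool) (c : Bool) (t h : ℕ) (D σ : ℤ)
    (hσ : σ = 0 ∨ ∃ k ≤ h, Doomed β S c t D k h ∧ σ = 4 * 2 ^ (h - k)) :
    claim β (List.replicate t c ++ S) h + σ ≤
      countWords (fun w => ver (w.reverse ++ (List.replicate t c ++ S))) h +
        6 * (2 ^ h - countWords (passes β ver S c t D) h) := by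
  induction h generalizing S c t D σ with
  | zero =>
    have hF : claim β (List.replicate t c ++ S) 0 = (β 0 0 (List.replicate t c ++ S)).toNat := by
      simp [claim, lowBits]
    rw [hF]
    simp only [countWords, passes, List.reverse_nil, List.nil_append, pow_zero]
    rcases hσ with rfl | ⟨k, hk, hd, rfl⟩
    · cases β 0 0 (List.replicate t c ++ S) <;> cases ver (List.replicate t c ++ S) <;>
        by_cases hD : 0 ≤ D <;> simp [hD]
    · obtain rfl : k = 0 := by omega
      have hD : ¬ 0 ≤ D := by
        simp only [Doomed] at hd
        omega
      cases β 0 0 (List.replicate t c ++ S) <;> cases ver (List.replicate t c ++ S) <;> simp [hD]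
  | succ h ih =>
    set L := List.replicate t c ++ S with hL
    have hcL : c :: L = List.replicate (t + 1) c ++ S := by simp [hL, List.replicate_succ]
    by_cases hD : -1 ≤ D
    · set D₁ : ℤ := 2 * -(β (h + 1) 0 L).toNat + digit β h 0 L (!c) with hD₁
      have hclaim := claim_add_claim_sub (β := β) L (!c) h
      rw [← hD₁, Bool.not_not] at hclaim
      have hD₁le : -3 ≤ D₁ := by
        have := le_digit (β := β) h 0 L (!c)
        have := toNat_cast_le (β (h + 1) 0 L)
        linarith
      have same : claim β (c :: L) h + σ ≤
          countWords (fun w => ver (w.reverse ++ (c :: L))) h +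
            6 * (2 ^ h - countWords (passes β ver S c (t + 1) (2 * D + digit β h t S c)) h) := by
        rw [hcL]
        refine ih S c (t + 1) _ σ ?_
        rcases hσ with rfl | ⟨k, hk, hd, rfl⟩
        · exact Or.inl rfl
        · rcases k with _ | k
          · simp only [Doomed] at hd
            omega
          · exact Or.inr ⟨k, by omega, hd, by rw [Nat.add_sub_add_right]⟩
      have other : claim β ((!c) :: L) h - (claim β ((!c) :: L) h + claim β (c :: L) h -
            claim β L (h + 1)) ≤
          countWords (fun w => ver (w.reverse ++ ((!c) :: L))) h +
            6 * (2 ^ h - countWords (passes β ver L (!c) 1 D₁) h) := by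
        rw [hclaim]
        rcases exists_doomed (β := β) L (!c) 1 h D₁ hD₁le with h₀ | ⟨k, hk, h₁, h₂⟩
        · have := ih L (!c) 1 D₁ 0 (Or.inl rfl)
          simp only [List.replicate_one, List.singleton_append] at this
          linarith
        · have := ih L (!c) 1 D₁ _ (Or.inr ⟨k, hk, h₁, rfl⟩)
          simp only [List.replicate_one, List.singleton_append] at this
          linarith
      have hcount : countWords (passes β ver S c t D) (h + 1) ≤
          countWords (passes β ver S c (t + 1) (2 * D + digit β h t S c)) h +
            countWords (passes β ver L (!c) 1 D₁) h := by
        rw [countWords.succ _ _ c]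
        refine add_le_add (countWords.mono fun w hw hp => ?_) (countWords.mono fun w hw hp => ?_)
        · simp only [passes, Bool.and_eq_true, if_true] at hp
          rw [← hw]
          exact hp.2
        · simp only [passes, Bool.and_eq_true, Bool.not_eq_self, if_false] at hp
          rw [hD₁, ← hw]
          exact hp.2
      have hver : countWords (fun w => ver (w.reverse ++ L)) (h + 1) =
          countWords (fun w => ver (w.reverse ++ (c :: L))) h +
            countWords (fun w => ver (w.reverse ++ ((!c) :: L))) h := by
        rw [countWords.succ _ _ c]
        simp
      rw [hver, pow_succ]
      push_cast
      have : (countWords (passes β ver S c t D) (h + 1) : ℤ) ≤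
          countWords (passes β ver S c (t + 1) (2 * D + digit β h t S c)) h +
            countWords (passes β ver L (!c) 1 D₁) h := by exact_mod_cast hcount
      linarith
    -- All walks through this node fail. The claim is below `2 * 2 ^ (h + 1)` and `σ` is at most `4
    -- * 2 ^ (h + 1)`, whence the constant 6.
    · have h0 : countWords (passes β ver S c t D) (h + 1) = 0 := by
        refine countWords.eq_zero fun w hw => ?_
        rcases w with _ | ⟨b, w⟩
        · simp at hw
        · simp [passes, hD]
      have hF := lowBits_lt (β := β) L 0 (h + 1 + 1)
      have hσ' : σ ≤ 4 * 2 ^ (h + 1) := by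
        rcases hσ with rfl | ⟨k, hk, hd, rfl⟩
        · positivity
        · gcongr
          · norm_num
          · omega
      rw [h0, claim]
      have : (0 : ℤ) ≤ countWords (fun w => ver (w.reverse ++ L)) (h + 1) := by positivity
      rw [pow_succ (2 : ℤ) (h + 1)] at hF
      push_cast
      linarith

/-! ### Honest proofs -/

/-- The number of accepting leaves below a node `S` of height `h`. -/
def leafCount (ver : List Bool → Bool) (S : List Bool) (h : ℕ) : ℕ :=
  countWords (fun w => ver (w.reverse ++ S)) h

theorem leafCount_succ (ver : List Bool → Bool) (S : List Bool) (h : ℕ) (c : Bool) :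
    leafCount ver S (h + 1) = leafCount ver (c :: S) h + leafCount ver ((!c) :: S) h := by
  rw [leafCount, countWords.succ _ _ c]
  simp [leafCount]

/-- The bits of the nodes of a tree of height `r` are those of the numbers of accepting leaves. -/
def Honest (β : ℕ → ℕ → List Bool → Bool) (ver : List Bool → Bool) (r : ℕ) : Prop :=
  ∀ m j S, m + j + S.length = r → β m j S = (leafCount ver S (m + j)).testBit m

theorem Honest.lowBits_eq {ver : List Bool → Bool} {r : ℕ} (hβ : Honest β ver r) (S : List Bool)
    (j m : ℕ) (h : m + j + S.length = r + 1) :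
    lowBits β S j m = (leafCount ver S (m + j - 1) % 2 ^ m : ℕ) := by
  induction m generalizing j with
  | zero => simp [lowBits, Nat.mod_one]
  | succ m ih =>
    rw [lowBits, ih (j + 1) (by omega), hβ m j S (by omega), Nat.mod_pow_succ,
      Nat.toNat_testBit]
    rw [show m + 1 + j - 1 = m + j by omega, show m + (j + 1) - 1 = m + j by omega]
    push_cast
    ring

/-- The count is at most `2 ^ h`, a value that it may attain; `h + 1` bits hold it without
truncation. -/
theorem Honest.claim_eq {ver : List Bool → Bool} {r : ℕ} (hβ : Honest β ver r) (S : List Bool)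
    (h : ℕ) (hr : h + S.length = r) : claim β S h = leafCount ver S h := by
  rw [claim, hβ.lowBits_eq S 0 (h + 1) (by omega), Nat.mod_eq_of_lt]
  · simp
  · have := countWords.le_pow (fun w => ver (w.reverse ++ S)) h
    rw [pow_succ]
    have : 0 < 2 ^ h := by positivity
    simp only [leafCount, add_zero, Nat.add_sub_cancel]
    omega

/-- The cutoff never rejects a nonnegative difference: the unread bits of each child amount to less
than `2 ^ w.length`, so `D ≤ -2` would make the difference negative. A new run starts with
difference zero, because the true counts are additive. -/
theorem Honest.passes {ver : List Bool → Bool} {r : ℕ} (hβ : Honest β ver r) (S : List Bool)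
    (c : Bool) (t : ℕ) (D : ℤ) (w : List Bool) (hr : w.length + t + S.length = r)
    (hD : 0 ≤ D * 2 ^ w.length + tail β S c t w.length) :
    CountTree.passes β ver S c t D w = true := by
  induction w generalizing S c t D with
  | nil =>
    have h := hβ 0 0 (List.replicate t c ++ S) (by simp at hr ⊢; omega)
    have hD' : 0 ≤ D := by simpa [tail, lowBits] using hD
    have : leafCount ver (List.replicate t c ++ S) 0 =
        (ver (List.replicate t c ++ S)).toNat := by simp [leafCount, countWords]
    rw [this] at h
    simp only [CountTree.passes, hD', decide_true, Bool.true_and, h]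
    cases ver (List.replicate t c ++ S) <;> simp
  | cons b w ih =>
    set L := List.replicate t c ++ S with hL
    have hlen : w.length + 1 + L.length = r := by simp [hL] at hr ⊢; omega
    have hD' : -1 ≤ D := by
      have h₁ := lowBits_lt (β := β) (c :: S) t (b :: w).length
      have h₂ := lowBits_lt (β := β) ((!c) :: S) t (b :: w).length
      have h₃ := lowBits_nonneg (β := β) S (t + 1) (b :: w).length
      rw [tail] at hD
      by_contra h
      have : D ≤ -2 := by omega
      nlinarith [pow_pos (two_pos : (0 : ℤ) < 2) (b :: w).length]
    simp only [CountTree.passes, hD', decide_true, Bool.true_and]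
    split_ifs with hb
    · refine ih S c (t + 1) _ (by simp at hr; omega) ?_
      rw [List.length_cons, tail_succ, pow_succ] at hD
      linarith
    · refine ih L b 1 _ (by omega) ?_
      have h := claim_add_claim_sub (β := β) L b w.length
      rw [← h, hβ.claim_eq _ _ (by simp; omega), hβ.claim_eq _ _ (by simp; omega),
        hβ.claim_eq _ _ (by omega), leafCount_succ ver L w.length b]
      push_cast
      linarith

end CountTree

/-! ### Addresses of the bits of the tree -/

namespace CountTree

/-- The address of the bit `β m j S`, most significant bit first. -/
def address (m j : ℕ) (S : List Bool) : List Bool :=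
  true :: (List.replicate m false ++ true :: (List.replicate j false ++ true :: S))

/-- The number with the given binary digits, most significant bit first. -/
def ofBits (w : List Bool) : ℕ := w.foldl (fun n b => Nat.bit b n) 0

theorem ofBits_append_singleton (w : List Bool) (b : Bool) :
    ofBits (w ++ [b]) = Nat.bit b (ofBits w) := by
  simp [ofBits]

/-- The leading `true` excludes leading zeros, so the word is the canonical binary expansion and can
be recovered from the number. -/
theorem bits_ofBits (w : List Bool) : (ofBits (true :: w)).bits = (true :: w).reverse := by
  induction w using List.reverseRecOn with
  | nil => simp [ofBits, Nat.bit]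
  | append_singleton w b ih =>
    rw [← List.cons_append, ofBits_append_singleton, Nat.bits_append_bit, ih]
    · simp
    · intro h
      rw [h] at ih
      simp at ih

theorem ofBits_lt (w : List Bool) : ofBits w < 2 ^ w.length := by
  induction w using List.reverseRecOn with
  | nil => simp [ofBits]
  | append_singleton w b ih =>
    rw [ofBits_append_singleton, List.length_append, List.length_singleton, pow_succ, Nat.bit_val]
    have := b.toNat_le
    omega

theorem replicate_append_cons_inj {m m' : ℕ} {u u' : List Bool}
    (h : List.replicate m false ++ true :: u = List.replicate m' false ++ true :: u') :
    m = m' ∧ u = u' := by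
  induction m generalizing m' with
  | zero => cases m' <;> simp_all [List.replicate_succ]
  | succ m ih =>
    cases m' with
    | zero => simp [List.replicate_succ] at h
    | succ m' =>
      simp only [List.replicate_succ, List.cons_append, List.cons.injEq, true_and] at h
      simpa using ih h

/-- The indices `m` and `j` are written in unary and ended by `true`, which makes the address
self-delimiting. An honest proof may thus assign the bits of the tree independently. -/
theorem ofBits_address_injective {m m' j j' : ℕ} {S S' : List Bool}
    (h : ofBits (address m j S) = ofBits (address m' j' S')) : m = m' ∧ j = j' ∧ S = S' := by
  have h₁ : (address m j S).reverse = (address m' j' S').reverse :=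
    (bits_ofBits _).symm.trans ((congrArg Nat.bits h).trans (bits_ofBits _))
  have h₂ := List.reverse_injective h₁
  simp only [address, List.cons.injEq, true_and] at h₂
  obtain ⟨rfl, h₃⟩ := replicate_append_cons_inj h₂
  obtain ⟨rfl, h₄⟩ := replicate_append_cons_inj h₃
  exact ⟨rfl, rfl, h₄⟩

theorem length_address (m j : ℕ) (S : List Bool) :
    (address m j S).length = m + j + S.length + 3 := by
  simp [address]; omega

/-! ### The six bits of a step and the transducer for their addresses -/

/-- The kinds of bits that are read at a step of the walk, which leads to a node by a run of equal
bits that starts at some node: the first bits of the last node and of this one, a bit of the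
root, a bit of the start of the run and a bit of each child of it. -/
inductive Kind : Type
  | last | here | root | start
  | child (d : Bool)

/-- The states of the transducer that computes the final parts of addresses. -/
inductive Scan : Type
  | init
  | run (b : Bool)
  | copy
  deriving Fintype

namespace Kind

/-- The state of the transducer after reading `b`. -/
def next : Kind → Scan → Bool → Scan
  | last, _, _ => .copy
  | here, _, _ => .copy
  | root, q, _ => q
  | _, .init, b => .run b
  | _, .run c, b => if b = c then .run c else .copy
  | _, .copy, _ => .copy

/-- The output of the transducer on reading `b`. -/
def out : Kind → Scan → Bool → List Bool
  | last, .init, _ => [true]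
  | here, .init, b => [true, b]
  | root, _, _ => [false]
  | start, .init, _ => [false]
  | start, .run c, b => if b = c then [false] else [true, b]
  | child _, .init, _ => []
  | child d, .run c, b => if b = c then [false] else [true, c == d, b]
  | _, _, b => [b]

/-- The output of the transducer at the end. -/
def final : Kind → Scan → List Bool
  | root, _ => [true]
  | start, .run _ => [true]
  | child d, .run c => [true, c == d]
  | _, _ => []

/-- The transduction of a word. -/
def transduce (k : Kind) : Scan → List Bool → List Bool
  | q, [] => k.final q
  | q, b :: L => k.out q b ++ transduce k (k.next q b) L

/-- The number of additional steps to the leaf, counted from the node in question. -/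
def extra : Kind → ℕ
  | last => 1
  | _ => 0

/-- The address of the bit of the given kind that is read at the node `L` of height `m`. -/
def word (k : Kind) (m : ℕ) (L : List Bool) : List Bool :=
  true :: (List.replicate (m + k.extra) false ++ true :: k.transduce .init L)

theorem transduce_copy (k : Kind) (hk : k ≠ root) (L : List Bool) :
    k.transduce .copy L = L := by
  induction L with
  | nil => cases k <;> simp_all [transduce, final]
  | cons b L ih =>
    have h₁ : k.next .copy b = .copy := by cases k <;> simp_all [next]
    have h₂ : k.out .copy b = [b] := by cases k <;> simp_all [out]
    rw [transduce, h₁, ih, h₂, List.singleton_append]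

theorem word_last (m : ℕ) (b : Bool) (L : List Bool) :
    word last m (b :: L) = address (m + 1) 0 L := by
  simp [word, address, extra, transduce, next, out, transduce_copy]

theorem word_here (m : ℕ) (b : Bool) (L : List Bool) :
    word here m (b :: L) = address m 0 (b :: L) := by
  simp [word, address, extra, transduce, next, out, transduce_copy]

theorem word_root (m : ℕ) (L : List Bool) : word root m L = address m L.length [] := by
  have : transduce root .init L = List.replicate L.length false ++ [true] := by
    induction L with
    | nil => rfl
    | cons b L ih => simp [transduce, out, next, ih, List.replicate_succ]
  simp [word, address, extra, this]

/-- The hypothesis on `S.head?` says that the run of `c` is maximal. Nodes are written last bit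
first, so the transducer meets the run first, turns it into the unary index, and copies the node `S`
at its start. -/
theorem transduce_start (c : Bool) (t : ℕ) (S : List Bool) (hS : S.head? ≠ some c) :
    transduce start (.run c) (List.replicate t c ++ S) =
      List.replicate t false ++ true :: S := by
  induction t with
  | zero =>
    rcases S with _ | ⟨b, S⟩
    · rfl
    · have : b ≠ c := by simpa using hS
      simp [transduce, out, next, this, transduce_copy]
  | succ t ih => simp [List.replicate_succ, transduce, out, next, ih]

theorem word_start (m t : ℕ) (c : Bool) (S : List Bool) (hS : S.head? ≠ some c) :
    word start m (List.replicate (t + 1) c ++ S) = address m (t + 1) S := by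
  simp [word, address, extra, List.replicate_succ, transduce, out, next, transduce_start, hS]

theorem transduce_child (d c : Bool) (t : ℕ) (S : List Bool) (hS : S.head? ≠ some c) :
    transduce (child d) (.run c) (List.replicate t c ++ S) =
      List.replicate t false ++ true :: (c == d) :: S := by
  induction t with
  | zero =>
    rcases S with _ | ⟨b, S⟩
    · rfl
    · have : b ≠ c := by simpa using hS
      simp [transduce, out, next, this, transduce_copy]
  | succ t ih => simp [List.replicate_succ, transduce, out, next, ih]

theorem word_child (d : Bool) (m t : ℕ) (c : Bool) (S : List Bool) (hS : S.head? ≠ some c) :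
    word (child d) m (List.replicate (t + 1) c ++ S) = address m t ((c == d) :: S) := by
  simp [word, address, extra, List.replicate_succ, transduce, out, next, transduce_child, hS]

/-- The kinds of bits, in the order in which they are read. -/
def all : List Kind := [last, here, root, start, child true, child false]

end Kind

/-- The addresses of the bits that are read at the node `L` of height `m`. -/
def stepWords (m : ℕ) (L : List Bool) : List (List Bool) := Kind.all.map fun k => k.word m L

/-- The addresses of the bits that are read on the walk from the node `L` along a path. -/
def walkWords : List Bool → List Bool → List (List Bool)
  | _, [] => []
  | L, b :: w => stepWords w.length (b :: L) ++ walkWords (b :: L) w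

theorem length_walkWords (L w : List Bool) : (walkWords L w).length = 6 * w.length := by
  induction w generalizing L with
  | nil => rfl
  | cons b w ih =>
    simp [walkWords, ih, stepWords, Kind.all]
    ring

/-! ### The automaton that checks the bits read -/

variable (a q : ℕ)

/-- The states of the automaton: the last bit of the path, the difference of the claims at the start
of the run of this bit (up to saturation), the excess of the claim of the root over the threshold
`a / q` (up to saturation), the bit read at the last node, and whether an error has been found. -/
abbrev WalkState : Type :=
  Option Bool × Set.Icc (-2 : ℤ) 1 × Set.Icc (-q : ℤ) 0 × Bool × Bool

variable {q}

/-- The initial state. -/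
def WalkState.init : WalkState q :=
  (none, ⟨0, by norm_num, by norm_num⟩, ⟨0, by simp, le_rfl⟩, false, false)

/-- The state after a step of the walk with the bit `b`, at which the bits `x` are read. -/
def WalkState.step (s : WalkState q) (b : Bool) (x : Fin 6 → Bool) : WalkState q :=
  let d := Set.projIcc (-2 : ℤ) 1 (by norm_num)
    (2 * (if s.1 = some b then (s.2.1 : ℤ) else -(x 0).toNat) +
      ((x 4).toNat + (x 5).toNat - (x 3).toNat))
  let e := Set.projIcc (-q : ℤ) 0 (by simp)
    (2 * (if s.1 = none then (q * (x 0).toNat - a : ℤ) else s.2.2.1) + q * (x 2).toNat)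
  (some b, d, e, x 1, s.2.2.2.2 || decide ((d : ℤ) = -2))

/-- The first bit of a list (`false` if there is none). -/
abbrev readBit (A : List Bool) : Bool := A.headD false

/-- The walk along a path, with the bits read as the beginning of a list; the second component of
the result is the rest of the list. -/
def walk : WalkState q → List Bool → List Bool → WalkState q × List Bool
  | s, [], A => (s, A)
  | s, b :: w, A => walk (s.step a b fun i => readBit (A.drop i)) w (A.drop 6)

/-- The decision at the end of the walk, when the original verifier decides `v`. -/
def WalkState.decide (s : WalkState q) (v : Bool) : Bool :=
  match s.1 with
  | none => v
  | some _ => !s.2.2.2.2 && Decidable.decide (0 ≤ (s.2.1 : ℤ)) &&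
      Decidable.decide (0 ≤ (s.2.2.1 : ℤ)) && (!s.2.2.2.1 || v)

/-- The excess of the claim of the root over the threshold in terms of the bits that have not yet
been read. -/
def rootTail (β : ℕ → ℕ → List Bool → Bool) (E : ℤ) (p m : ℕ) : ℤ :=
  E * 2 ^ m + q * lowBits β [] (p + 1) m

/-- Saturation commutes with a Horner step: from `D ≤ -2` follows `2 * D + x ≤ -2`, and from `1 ≤ D`
follows `1 ≤ 2 * D + x`. -/
theorem val_projIcc_two_mul (D x : ℤ) (h₁ : -1 ≤ x) (h₂ : x ≤ 2) :
    (Set.projIcc (-2 : ℤ) 1 (by norm_num)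
      (2 * (Set.projIcc (-2 : ℤ) 1 (by norm_num) D : ℤ) + x)) =
    Set.projIcc (-2 : ℤ) 1 (by norm_num) (2 * D + x) := by
  ext
  simp only [Set.coe_projIcc]
  omega

/-- The same for the root: an excess `E ≤ -q` stays at most `-q`, and a nonnegative one stays
nonnegative. -/
theorem val_projIcc_two_mul' (E : ℤ) (b : Bool) :
    (Set.projIcc (-q : ℤ) 0 (by simp)
      (2 * (Set.projIcc (-q : ℤ) 0 (by simp) E : ℤ) + q * b.toNat)) =
    Set.projIcc (-q : ℤ) 0 (by simp) (2 * E + q * b.toNat) := by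
  ext
  simp only [Set.coe_projIcc]
  cases b <;> simp <;> omega

theorem map_stepWords (β : ℕ → ℕ → List Bool → Bool) (π : ℕ → Bool)
    (hπ : ∀ m j S, π (ofBits (address m j S)) = β m j S) (m t : ℕ) (b c : Bool) (L S : List Bool)
    (hS : S.head? ≠ some c) (hL : b :: L = List.replicate (t + 1) c ++ S) :
    (stepWords m (b :: L)).map (fun u => π (ofBits u)) =
      [β (m + 1) 0 L, β m 0 (b :: L), β m (L.length + 1) [], β m (t + 1) S,
        β m t ((c == true) :: S), β m t ((c == false) :: S)] := by
  have h₁ := Kind.word_start m t c S hS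
  have h₂ := Kind.word_child true m t c S hS
  have h₃ := Kind.word_child false m t c S hS
  rw [← hL] at h₁ h₂ h₃
  simp [stepWords, Kind.all, h₁, h₂, h₃, Kind.word_last, Kind.word_here, Kind.word_root, hπ]

theorem walk_cons (s : WalkState q) (b : Bool) (w : List Bool) (x₀ x₁ x₂ x₃ x₄ x₅ : Bool)
    (A : List Bool) : walk a s (b :: w) ([x₀, x₁, x₂, x₃, x₄, x₅] ++ A) =
      walk a (s.step a b ![x₀, x₁, x₂, x₃, x₄, x₅]) w A := by
  rw [walk]
  congr 2
  funext i
  fin_cases i <;> rfl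

theorem le_of_passes {β : ℕ → ℕ → List Bool → Bool} {ver : List Bool → Bool} {S : List Bool}
    {c : Bool} {t : ℕ} {D : ℤ} {w : List Bool} (h : passes β ver S c t D w = true) : -1 ≤ D := by
  cases w with
  | nil =>
    simp only [passes, Bool.and_eq_true, decide_eq_true_eq] at h
    linarith [h.1]
  | cons b w =>
    simp only [passes, Bool.and_eq_true, decide_eq_true_eq] at h
    exact h.1

theorem digit_eq (β : ℕ → ℕ → List Bool → Bool) (m t : ℕ) (S : List Bool) (c : Bool) :
    digit β m t S c = (β m t ((c == true) :: S)).toNat + (β m t ((c == false) :: S)).toNat -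
      (β m (t + 1) S).toNat := by
  cases c <;> simp [digit, add_comm]

theorem digit_le (β : ℕ → ℕ → List Bool → Bool) (m t : ℕ) (S : List Bool) (c : Bool) :
    digit β m t S c ≤ 2 := by
  have := toNat_cast_le (β m t (c :: S))
  have := toNat_cast_le (β m t ((!c) :: S))
  have := toNat_cast_nonneg (β m (t + 1) S)
  rw [digit]
  linarith

theorem rootTail_succ (β : ℕ → ℕ → List Bool → Bool) (E : ℤ) (p m : ℕ) :
    rootTail (q := q) β E p (m + 1) =
      rootTail (q := q) β (2 * E + q * (β m (p + 1) []).toNat) (p + 1) m := by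
  simp only [rootTail, lowBits]
  ring

/-- The automaton, in the midst of a run, computes what `CountTree.passes` specifies. -/
theorem decide_walk (β : ℕ → ℕ → List Bool → Bool) (ver : List Bool → Bool) (π : ℕ → Bool)
    (hπ : ∀ m j S, π (ofBits (address m j S)) = β m j S) (hq : 0 < q) (A w : List Bool) :
    ∀ (S : List Bool) (c : Bool) (t : ℕ) (D E : ℤ) (f : Bool) (L : List Bool)
      (_ : S.head? ≠ some c) (_ : L = List.replicate (t + 1) c ++ S) (_ : D ≤ -2 → f = true),
    (walk a (some c, Set.projIcc (-2) 1 (by norm_num) D, Set.projIcc (-q : ℤ) 0 (by simp) E,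
        β w.length 0 L, f) w
      ((walkWords L w).map (fun u => π (ofBits u)) ++ A)).2 = A ∧
    ((walk a (some c, Set.projIcc (-2) 1 (by norm_num) D, Set.projIcc (-q : ℤ) 0 (by simp) E,
        β w.length 0 L, f) w
      ((walkWords L w).map (fun u => π (ofBits u)) ++ A)).1.decide
        (ver (w.reverse ++ L)) = true ↔
      f = false ∧ passes β ver S c (t + 1) D w = true ∧
        0 ≤ rootTail (q := q) β E L.length w.length) := by
  induction w with
  | nil =>
    rintro S c t D E f L - rfl hf
    refine ⟨rfl, ?_⟩
    simp only [walkWords, List.map_nil, List.nil_append, walk, WalkState.decide, passes, rootTail,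
      lowBits, List.length_nil, List.reverse_nil, Set.coe_projIcc, Bool.and_eq_true,
      decide_eq_true_eq, Bool.not_eq_true']
    have h₁ : 0 ≤ max (-2) (min 1 D) ↔ 0 ≤ D := by omega
    have h₂ : 0 ≤ max (-(q : ℤ)) (min 0 E) ↔ 0 ≤ E := by omega
    rw [h₁, h₂]
    simp only [pow_zero, mul_one, mul_zero, add_zero]
    tauto
  | cons b w ih =>
    intro S c t D E f L hS hL hf
    rw [walkWords, List.map_append, List.append_assoc, List.length_cons, rootTail_succ,
      List.reverse_cons, List.append_assoc, List.singleton_append]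
    by_cases hb : b = c
    · subst hb
      have hL' : b :: L = List.replicate (t + 1 + 1) b ++ S := by
        rw [hL, List.replicate_succ (n := t + 1), List.cons_append]
      rw [map_stepWords β π hπ w.length (t + 1) b b L S hS hL', walk_cons]
      have e : WalkState.step a (some b, Set.projIcc (-2) 1 (by norm_num) D,
          Set.projIcc (-q : ℤ) 0 (by simp) E, β (w.length + 1) 0 L, f) b
          ![β (w.length + 1) 0 L, β w.length 0 (b :: L), β w.length (L.length + 1) [],
            β w.length (t + 1 + 1) S, β w.length (t + 1) ((b == true) :: S),
            β w.length (t + 1) ((b == false) :: S)] =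
          (some b, Set.projIcc (-2) 1 (by norm_num) (2 * D + digit β w.length (t + 1) S b),
            Set.projIcc (-q : ℤ) 0 (by simp) (2 * E + q * (β w.length (L.length + 1) []).toNat),
            β w.length 0 (b :: L), f || Decidable.decide
              (2 * D + digit β w.length (t + 1) S b ≤ -2)) := by
        have h₁ := val_projIcc_two_mul D (digit β w.length (t + 1) S b) (le_digit ..)
          (digit_le ..)
        have h₂ := val_projIcc_two_mul' (q := q) E (β w.length (L.length + 1) [])
        rw [digit_eq] at h₁ ⊢
        simp only [WalkState.step, Matrix.cons_val, if_true, reduceCtorEq, if_false]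
        rw [h₁, h₂, Set.coe_projIcc]
        congr 5
        simp only [decide_eq_decide]
        omega
      rw [e]
      obtain ⟨h₁, h₂⟩ := ih S b (t + 1) (2 * D + digit β w.length (t + 1) S b)
        (2 * E + q * (β w.length (L.length + 1) []).toNat)
        (f || Decidable.decide (2 * D + digit β w.length (t + 1) S b ≤ -2)) (b :: L) hS hL'
        (fun h => by rw [decide_eq_true h, Bool.or_true])
      refine ⟨h₁, h₂.trans ?_⟩
      simp only [passes, if_true, Bool.or_eq_false_iff, decide_eq_false_iff_not, Bool.and_eq_true,
        decide_eq_true_eq, List.length_cons]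
      constructor
      · rintro ⟨⟨hf', -⟩, hp, hr⟩
        refine ⟨hf', ⟨?_, hp⟩, hr⟩
        -- By the invariant `hf`, a value `D ≤ -2` would have raised the error flag earlier. The
        -- automaton tests a difference when it is formed, `passes` one step later.
        by_contra h
        rw [hf (by omega)] at hf'
        cases hf'
      · rintro ⟨hf', ⟨-, hp⟩, hr⟩
        refine ⟨⟨hf', ?_⟩, hp, hr⟩
        have := le_of_passes hp
        omega
    -- The path bit changes: the test of `S` is abandoned and a run that tests `L` begins, with the
    -- top bit of `L` (kind `last`) as its initial value.
    · have hL' : b :: L = List.replicate (0 + 1) b ++ L := rfl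
      have hhead : L.head? ≠ some b := by
        rw [hL]
        simpa [List.replicate_succ] using fun h => hb h.symm
      rw [map_stepWords β π hπ w.length 0 b b L L hhead hL', walk_cons]
      have e : WalkState.step a (some c, Set.projIcc (-2) 1 (by norm_num) D,
          Set.projIcc (-q : ℤ) 0 (by simp) E, β (w.length + 1) 0 L, f) b
          ![β (w.length + 1) 0 L, β w.length 0 (b :: L), β w.length (L.length + 1) [],
            β w.length (0 + 1) L, β w.length 0 ((b == true) :: L),
            β w.length 0 ((b == false) :: L)] =
          (some b, Set.projIcc (-2) 1 (by norm_num)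
              (2 * -(β (w.length + 1) 0 L).toNat + digit β w.length 0 L b),
            Set.projIcc (-q : ℤ) 0 (by simp) (2 * E + q * (β w.length (L.length + 1) []).toNat),
            β w.length 0 (b :: L), f || Decidable.decide
              (2 * -((β (w.length + 1) 0 L).toNat : ℤ) + digit β w.length 0 L b ≤ -2)) := by
        have h₂ := val_projIcc_two_mul' (q := q) E (β w.length (L.length + 1) [])
        have hcb : ¬ some c = some b := by simpa using fun h => hb h.symm
        rw [digit_eq]
        simp only [WalkState.step, Matrix.cons_val, hcb, reduceCtorEq, if_false]
        rw [h₂, Set.coe_projIcc]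
        congr 5
        simp only [decide_eq_decide]
        omega
      rw [e]
      obtain ⟨h₁, h₂⟩ := ih L b 0 (2 * -(β (w.length + 1) 0 L).toNat + digit β w.length 0 L b)
        (2 * E + q * (β w.length (L.length + 1) []).toNat)
        (f || Decidable.decide
          (2 * -((β (w.length + 1) 0 L).toNat : ℤ) + digit β w.length 0 L b ≤ -2)) (b :: L) hhead hL'
        (fun h => by rw [decide_eq_true h, Bool.or_true])
      refine ⟨h₁, h₂.trans ?_⟩
      rw [passes, if_neg hb, ← hL]
      simp only [Bool.or_eq_false_iff, decide_eq_false_iff_not, Bool.and_eq_true,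
        decide_eq_true_eq, List.length_cons]
      constructor
      · rintro ⟨⟨hf', -⟩, hp, hr⟩
        refine ⟨hf', ⟨?_, hp⟩, hr⟩
        by_contra h
        rw [hf (by omega)] at hf'
        cases hf'
      · rintro ⟨hf', ⟨-, hp⟩, hr⟩
        refine ⟨⟨hf', ?_⟩, hp, hr⟩
        have := le_of_passes hp
        omega

/-- The automaton computes what `CountTree.passes` specifies and compares the claim of the root with
the threshold. -/
theorem decide_walk_init (β : ℕ → ℕ → List Bool → Bool) (ver : List Bool → Bool) (π : ℕ → Bool)
    (hπ : ∀ m j S, π (ofBits (address m j S)) = β m j S) (hq : 0 < q) (A w : List Bool) (hw : w ≠ []) :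
    (walk a (WalkState.init (q := q)) w
      ((walkWords [] w).map (fun u => π (ofBits u)) ++ A)).2 = A ∧
    ((walk a (WalkState.init (q := q)) w
      ((walkWords [] w).map (fun u => π (ofBits u)) ++ A)).1.decide (ver w.reverse) = true ↔
      passes β ver [] true 0 (-(β w.length 0 []).toNat) w = true ∧
        (a : ℤ) * 2 ^ w.length ≤ q * claim β [] w.length) := by
  obtain ⟨b, w, rfl⟩ := List.exists_cons_of_ne_nil hw
  have hL : [b] = List.replicate (0 + 1) b ++ [] := rfl
  rw [walkWords, List.map_append, List.append_assoc,
    map_stepWords β π hπ w.length 0 b b [] [] (by simp) hL, walk_cons]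
  have e : WalkState.step a (WalkState.init (q := q)) b
      ![β (w.length + 1) 0 [], β w.length 0 [b], β w.length ([] : List Bool).length.succ [],
        β w.length (0 + 1) [], β w.length 0 [b == true], β w.length 0 [b == false]] =
      (some b, Set.projIcc (-2) 1 (by norm_num)
          (2 * -(β (w.length + 1) 0 []).toNat + digit β w.length 0 [] b),
        Set.projIcc (-q : ℤ) 0 (by simp)
          (2 * (q * (β (w.length + 1) 0 []).toNat - a) + q * (β w.length 1 []).toNat),
        β w.length 0 [b], Decidable.decide
          (2 * -((β (w.length + 1) 0 []).toNat : ℤ) + digit β w.length 0 [] b ≤ -2)) := by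
    rw [digit_eq]
    simp only [WalkState.step, WalkState.init, Matrix.cons_val, reduceCtorEq, if_false, if_true,
      Bool.false_or, Set.coe_projIcc]
    congr 4
    simp only [decide_eq_decide]
    omega
  erw [e]
  obtain ⟨h₁, h₂⟩ := decide_walk a (q := q) β ver π hπ hq A w [] b 0 _
    (2 * (q * (β (w.length + 1) 0 []).toNat - a) + q * (β w.length 1 []).toNat) _ [b] (by simp) hL
    (fun h => decide_eq_true h)
  refine ⟨h₁, ?_⟩
  rw [List.reverse_cons]
  refine h₂.trans ?_
  -- At the root the run is empty and its bit `true` is arbitrary: both branches of `passes` start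
  -- the test of the root.
  have h₃ : passes β ver [] true 0 (-(β (w.length + 1) 0 []).toNat) (b :: w) =
      passes β ver [] b 1 (2 * -(β (w.length + 1) 0 []).toNat + digit β w.length 0 [] b) w := by
    have : -1 ≤ -((β (w.length + 1) 0 []).toNat : ℤ) := by
      have := toNat_cast_le (β (w.length + 1) 0 [])
      linarith
    rw [passes]
    simp only [this, decide_true, Bool.true_and, List.replicate_zero, List.nil_append]
    split_ifs with hb
    · rw [hb]
    · rfl
  have h₄ : rootTail (q := q) β
      (2 * (q * (β (w.length + 1) 0 []).toNat - a) + q * (β w.length 1 []).toNat) [b].length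
        w.length = q * claim β [] (w.length + 1) - a * 2 ^ (w.length + 1) := by
    simp only [rootTail, claim, lowBits, List.length_singleton]
    ring
  rw [h₄, sub_nonneg]
  change _ ↔ passes β ver [] true 0 (-(β (w.length + 1) 0 []).toNat) (b :: w) = true ∧
    (a : ℤ) * 2 ^ (w.length + 1) ≤ q * claim β [] (w.length + 1)
  rw [h₃]
  constructor
  · rintro ⟨-, h⟩; exact h
  · rintro h
    refine ⟨?_, h⟩
    have := le_of_passes h.1
    rw [decide_eq_false_iff_not]
    omega

end CountTree

/-! ### Running programs -/

namespace Prog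

section

variable {K ρ : Type} [DecidableEq K]

theorem Runs.of_eq {p : Prog K ρ} {v v' w' : State ρ} {S S' U' : K → List (Option Bool)} {t u : ℕ}
    (h : Runs p v S v' S' t) (hv : v' = w') (hS : S' = U') (ht : t ≤ u) : Runs p v S w' U' u := by
  subst hv hS
  exact h.mono ht

/-- `Runs.seq` for a second program whose initial store is known in another form. -/
theorem Runs.andThen {p q : Prog K ρ} {v v' w' v'' : State ρ}
    {S S' U' S'' : K → List (Option Bool)} {t t' : ℕ}
    (h : Runs p v S v' S' t) (hv : v' = w') (hS : S' = U') (h' : Runs q w' U' v'' S'' t') :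
    Runs (p ;; q) v S v'' S'' (t + t') :=
  (h.of_eq hv hS le_rfl).seq h'

/-- Used to split a run of `scan` into its first pop and its loop; this pop is also the one that
ends the body of the preceding iteration. -/
theorem Runs.seq_inv {p q : Prog K ρ} {v v'' : State ρ} {S S'' : K → List (Option Bool)} {t : ℕ}
    (h : Runs (p ;; q) v S v'' S'' t) : ∃ v' S' t₁ t₂, Runs p v S v' S' t₁ ∧
      Runs q v' S' v'' S'' t₂ ∧ t₁ + t₂ ≤ t := by
  generalize hr : p ;; q = r at h
  induction h with
  | seq h₁ h₂ =>
    cases hr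
    exact ⟨_, _, _, _, h₁, h₂, le_rfl⟩
  | mono _ hle ih =>
    obtain ⟨v', S', t₁, t₂, h₁, h₂, h₃⟩ := ih hr
    exact ⟨v', S', t₁, t₂, h₁, h₂, h₃.trans hle⟩
  | _ => cases hr

/-- The register contains a bit. -/
def isBit (v : State ρ) : Bool :=
  match v.1 with
  | some (some _) => true
  | _ => false

/-- The program that pops symbols from the stack `k` and runs `body` after each of them, until a
separator has been popped or the stack is empty. -/
def scan (k : K) (body : Prog K ρ) : Prog K ρ := .pop k ;; .loop isBit (body ;; .pop k)

theorem Runs.scan_done {k : K} {body : Prog K ρ} {v : State ρ} {S : K → List (Option Bool)}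
    (h : ∀ b, (S k).head? ≠ some (some b)) :
    Runs (scan k body) v S ((S k).head?, v.2) (update S k (S k).tail) 2 := by
  refine (Runs.pop k v S).seq (Runs.loop_done ?_)
  unfold isBit
  split
  · next b hb => exact absurd hb (h b)
  · rfl

theorem Runs.scan_cons {k : K} {body : Prog K ρ} {v v' v'' : State ρ}
    {S S' S'' : K → List (Option Bool)} {b : Bool} {l : List (Option Bool)} {t t' : ℕ}
    (h : S k = some b :: l) (hb : Runs body (some (some b), v.2) (update S k l) v' S' t)
    (hr : Runs (scan k body) v' S' v'' S'' t') :
    Runs (scan k body) v S v'' S'' (t + t' + 2) := by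
  obtain ⟨v₁, S₁, t₁, t₂, h₁, h₂, h₃⟩ := hr.seq_inv
  have h₄ := Runs.pop k v S
  rw [h] at h₄
  refine (h₄.seq (Runs.loop_step (t' := t₂) rfl (hb.seq h₁) h₂)).mono ?_
  omega

/-- The effect of `Prog.scan` on a stack with the bits `l` on top, in terms of the memory and
the other stacks after each part of `l`. -/
theorem Runs.scan_list {k : K} {body : Prog K ρ} {v v' : State ρ}
    {S S' : K → List (Option Bool)} (l : List Bool) (rest : List (Option Bool))
    (m : List Bool → ρ) (T : List Bool → K → List (Option Bool)) (c : ℕ)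
    (hm : v.2 = m []) (hS : S = update (T []) k (l.map some ++ rest))
    (hrest : ∀ b, rest.head? ≠ some (some b))
    (hbody : ∀ l₁ b l₂, l₁ ++ b :: l₂ = l → ∃ r, Runs body (some (some b), m l₁)
      (update (T l₁) k (l₂.map some ++ rest)) (r, m (l₁ ++ [b]))
      (update (T (l₁ ++ [b])) k (l₂.map some ++ rest)) c)
    (hv' : v' = (rest.head?, m l)) (hS' : S' = update (T l) k rest.tail) :
    Runs (scan k body) v S v' S' ((c + 2) * l.length + 2) := by
  subst hS hv' hS'
  obtain ⟨r, m₀⟩ := v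
  obtain rfl : m₀ = m [] := hm
  -- The induction is on the part `l₂` still to be read; `m` and `T` depend on the part already
  -- consumed.
  suffices h : ∀ l₂ l₁ r, l₁ ++ l₂ = l → Runs (scan k body) (r, m l₁)
      (update (T l₁) k (l₂.map some ++ rest)) (rest.head?, m l) (update (T l) k rest.tail)
      ((c + 2) * l₂.length + 2) from h l [] r rfl
  intro l₂
  induction l₂ with
  | nil =>
    rintro l₁ r h
    have h' : l₁ = l := by simpa using h
    subst h'
    refine (Runs.scan_done ?_).of_eq ?_ ?_ (by simp)
    · simpa using hrest
    · simp
    · simp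
  | cons b l₂ ih =>
    intro l₁ r h
    obtain ⟨r', hb⟩ := hbody l₁ b l₂ h
    have hr := ih (l₁ ++ [b]) r' (by simp [← h])
    refine (Runs.scan_cons (t := c) (l := l₂.map some ++ rest) (b := b) (by simp) ?_ hr).mono ?_
    · simpa using hb
    · simp only [List.length_cons]
      ring_nf
      omega

end

end Prog

/-! ### The stacks of the concrete programs -/

/-- The stacks of the programs below. -/
inductive Reg : Type
  | inp | x | l | cnt | z | w | out | rt | tmp
  deriving DecidableEq

instance : Fintype Reg :=
  ⟨{.inp, .x, .l, .cnt, .z, .w, .out, .rt, .tmp}, fun k => by cases k <;> simp⟩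

/-- The contents of these stacks. -/
structure Stacks where
  inp : List (Option Bool) := []
  x : List (Option Bool) := []
  l : List (Option Bool) := []
  cnt : List (Option Bool) := []
  z : List (Option Bool) := []
  w : List (Option Bool) := []
  out : List (Option Bool) := []
  rt : List (Option Bool) := []
  tmp : List (Option Bool) := []

namespace Stacks

/-- The content of a stack. -/
def get (s : Stacks) : Reg → List (Option Bool)
  | .inp => s.inp
  | .x => s.x
  | .l => s.l
  | .cnt => s.cnt
  | .z => s.z
  | .w => s.w
  | .out => s.out
  | .rt => s.rt
  | .tmp => s.tmp

variable (s : Stacks) (a : List (Option Bool))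

@[simp] theorem get_inp : s.get .inp = s.inp := rfl
@[simp] theorem get_x : s.get .x = s.x := rfl
@[simp] theorem get_l : s.get .l = s.l := rfl
@[simp] theorem get_cnt : s.get .cnt = s.cnt := rfl
@[simp] theorem get_z : s.get .z = s.z := rfl
@[simp] theorem get_w : s.get .w = s.w := rfl
@[simp] theorem get_out : s.get .out = s.out := rfl
@[simp] theorem get_rt : s.get .rt = s.rt := rfl
@[simp] theorem get_tmp : s.get .tmp = s.tmp := rfl

@[simp] theorem update_inp : update s.get .inp a = get { s with inp := a } := by
  funext k; cases k <;> rfl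
@[simp] theorem update_x : update s.get .x a = get { s with x := a } := by
  funext k; cases k <;> rfl
@[simp] theorem update_l : update s.get .l a = get { s with l := a } := by
  funext k; cases k <;> rfl
@[simp] theorem update_cnt : update s.get .cnt a = get { s with cnt := a } := by
  funext k; cases k <;> rfl
@[simp] theorem update_z : update s.get .z a = get { s with z := a } := by
  funext k; cases k <;> rfl
@[simp] theorem update_w : update s.get .w a = get { s with w := a } := by
  funext k; cases k <;> rfl
@[simp] theorem update_out : update s.get .out a = get { s with out := a } := by
  funext k; cases k <;> rfl
@[simp] theorem update_rt : update s.get .rt a = get { s with rt := a } := by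
  funext k; cases k <;> rfl
@[simp] theorem update_tmp : update s.get .tmp a = get { s with tmp := a } := by
  funext k; cases k <;> rfl

theorem empty_eq : (fun _ => [] : Reg → List (Option Bool)) = get {} := by
  funext k; cases k <;> rfl

end Stacks

namespace Prog

variable {ρ : Type}

/-- Push the symbol in the register. -/
abbrev copy (k : Reg) : Prog Reg ρ := .push k fun v => v.1

/-- Push a fixed symbol. -/
abbrev put (k : Reg) (s : Option Bool) : Prog Reg ρ := .push k fun _ => some s

/-- Remove the bits on top of a stack. -/
abbrev drain (k : Reg) : Prog Reg ρ := scan k (.load id)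

/-- Moves the bits on the stack `src` to the stack `dst`, where they end up in reverse. -/
theorem Runs.copy_scan {src dst : Reg} (hne : dst ≠ src) (l : List Bool)
    (rest : List (Option Bool)) (v : State ρ) (S : Reg → List (Option Bool))
    (h : S src = l.map some ++ rest) (hrest : ∀ b, rest.head? ≠ some (some b)) :
    Runs (scan src (copy dst)) v S (rest.head?, v.2)
      (update (update S src rest.tail) dst (l.reverse.map some ++ S dst)) (3 * l.length + 2) := by
  refine Runs.scan_list l rest (fun _ => v.2)
    (fun l₁ => update S dst (l₁.reverse.map some ++ S dst)) 1 rfl ?_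
    hrest (fun l₁ b l₂ _ => ⟨_, (Runs.push ..).of_eq rfl ?_ le_rfl⟩) rfl ?_
  · simp [← h]
  · rw [update_comm hne.symm]
    simp [hne]
  · rw [update_comm hne.symm]

theorem Runs.drain (k : Reg) (l : List Bool) (v : State ρ) (S : Reg → List (Option Bool))
    (h : S k = l.map some) : Runs (drain k) v S (none, v.2) (update S k []) (3 * l.length + 2) :=
  Runs.scan_list l [] (fun _ => v.2) (fun _ => S) 1 rfl (by simp [← h]) (by simp)
    (fun l₁ b l₂ _ => ⟨_, Runs.load ..⟩) rfl rfl

end Prog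

/-! ### The program that writes the queries -/

namespace QueryProg

open Prog CountTree

/-- The memory: the state of the transducer, the carry of an addition and a flag. -/
abbrev Mem : Type := Scan × Bool × Bool

/-- Copies the input to the stack `x` (in reverse), its second block to the stack `l`, and three
more bits than the length of this block to the counter. -/
def pre : Prog Reg Mem :=
  scan .inp (copy .x) ;; put .x none ;;
    scan .inp (copy .x ;; copy .l ;; put .cnt (some false)) ;; put .x none ;;
    put .cnt (some false) ;; put .cnt (some false) ;; put .cnt (some false)

theorem runs_pre (x R : List Bool) (m : Mem) :
    Runs pre (none, m) (Stacks.get { inp := encodeBlocks [x, R] }) (some none, m)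
      (Stacks.get { x := (encodeBlocks [x, R]).reverse, l := R.reverse.map some,
                    cnt := List.replicate (R.length + 3) (some false) })
      (5 * (x.length + R.length) + 10) := by
  have h₁ := Runs.copy_scan (ρ := Mem) (src := .inp) (dst := .x) (by decide) x
    (none :: (R.map some ++ [none])) (none, m) (Stacks.get { inp := encodeBlocks [x, R] })
    (by simp [encodeBlocks]) (by simp)
  have h₃ : Runs (scan .inp (copy .x ;; copy .l ;; put .cnt (some false))) (some none, m)
      (Stacks.get { inp := R.map some ++ [none], x := none :: x.reverse.map some }) (some none, m)
      (Stacks.get { x := R.reverse.map some ++ none :: x.reverse.map some, l := R.reverse.map some,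
                    cnt := List.replicate R.length (some false) }) (5 * R.length + 2) := by
    refine Runs.scan_list R [none] (fun _ => m) (fun l₁ => Stacks.get
      { x := l₁.reverse.map some ++ none :: x.reverse.map some, l := l₁.reverse.map some,
        cnt := List.replicate l₁.length (some false) }) 3 rfl (by simp) (by simp) ?_ rfl (by simp)
    intro l₁ b l₂ _
    refine ⟨_, ((Runs.push ..).seq ((Runs.push ..).seq (Runs.push ..))).of_eq rfl ?_ le_rfl⟩
    simp [List.replicate_succ]
  refine Runs.of_eq (h₁.seq ((Runs.push ..).andThen rfl (by simp) (h₃.seq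
    ((Runs.push ..).seq ((Runs.push ..).seq ((Runs.push ..).seq (Runs.push ..))))))) rfl ?_ ?_
  · simp [encodeBlocks, List.replicate_succ]
  · omega

/-- Writes the query of the given kind; the stack `l` contains the node and the stack `rt` the rest
of the path. -/
def emit (k : Kind) : Prog Reg Mem :=
  put .out none ;; put .out (some true) ;;
    .push .out (fun _ => if k.extra = 1 then some (some false) else none) ;;
    scan .rt (copy .tmp ;; put .out (some false)) ;; scan .tmp (copy .rt) ;;
    put .out (some true) ;; .load (fun v => (v.1, (.init, v.2.2))) ;;
    scan .l (copy .tmp ;;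
      .push .out (fun v => v.1.bind fun s => s.bind fun b => ((k.out v.2.1 b)[0]?).map some) ;;
      .push .out (fun v => v.1.bind fun s => s.bind fun b => ((k.out v.2.1 b)[1]?).map some) ;;
      .push .out (fun v => v.1.bind fun s => s.bind fun b => ((k.out v.2.1 b)[2]?).map some) ;;
      .load (fun v => (v.1, (match v.1 with
        | some (some b) => k.next v.2.1 b
        | _ => v.2.1, v.2.2)))) ;;
    .push .out (fun v => ((k.final v.2.1)[0]?).map some) ;;
    .push .out (fun v => ((k.final v.2.1)[1]?).map some) ;;
    scan .tmp (copy .l)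

/-- The state of the transducer after reading a word. -/
def state (k : Kind) (l : List Bool) : Scan := l.foldl k.next .init

/-- The output of the transducer on reading a word, without the final part. -/
def output (k : Kind) : Scan → List Bool → List Bool
  | _, [] => []
  | q, b :: l => k.out q b ++ output k (k.next q b) l

theorem output_append (k : Kind) (q : Scan) (l : List Bool) (b : Bool) :
    output k q (l ++ [b]) = output k q l ++ k.out (l.foldl k.next q) b := by
  induction l generalizing q with
  | nil => simp [output]
  | cons c l ih => simp [output, ih]

theorem transduce_eq (k : Kind) (q : Scan) (l : List Bool) :
    k.transduce q l = output k q l ++ k.final (l.foldl k.next q) := by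
  induction l generalizing q with
  | nil => simp [output, Kind.transduce]
  | cons c l ih => simp [output, ih, Kind.transduce]

theorem length_out_le (k : Kind) (q : Scan) (b : Bool) : (k.out q b).length ≤ 3 := by
  rcases k with _ | _ | _ | _ | d <;> rcases q with _ | c | _ <;> simp only [Kind.out] <;>
    (try split_ifs) <;> simp

theorem length_final_le (k : Kind) (q : Scan) : (k.final q).length ≤ 2 := by
  rcases k with _ | _ | _ | _ | d <;> rcases q with _ | c | _ <;> simp [Kind.final]

theorem push_three (l : List Bool) (hl : l.length ≤ 3) (S : List (Option Bool)) :
    ((l[2]?).map some).toList ++ (((l[1]?).map some).toList ++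
      (((l[0]?).map some).toList ++ S)) = l.reverse.map some ++ S := by
  rcases l with _ | ⟨a, _ | ⟨b, _ | ⟨c, _ | ⟨d, l⟩⟩⟩⟩ <;> simp at hl ⊢
  omega

theorem push_two (l : List Bool) (hl : l.length ≤ 2) (S : List (Option Bool)) :
    ((l[1]?).map some).toList ++ (((l[0]?).map some).toList ++ S) =
      l.reverse.map some ++ S := by
  rcases l with _ | ⟨a, _ | ⟨b, _ | ⟨c, l⟩⟩⟩ <;> simp at hl ⊢

/-- Addresses are generated most significant bit first. Pushing them onto `out` reverses them into
the order of `Nat.bits`, and for the same reason the separator that follows the block is pushed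
first. The scans of `rt` and `l` save their stacks on `tmp` and restore them. -/
theorem runs_emit (k : Kind) (r : Option (Option Bool)) (m : Mem) (W L : List Bool) (s : Stacks)
    (hrt : s.rt = W.map some) (hl : s.l = L.map some) (htmp : s.tmp = []) :
    ∃ q, Runs (emit k) (r, m) s.get (none, (q, m.2))
      (Stacks.get { s with out := (k.word W.length L).reverse.map some ++ none :: s.out })
      (20 * (W.length + L.length + 1)) := by
  refine ⟨state k L, ?_⟩
  set E := (List.replicate k.extra (some false) ++ some true :: none :: s.out) with hE
  have h₁ : Runs (scan .rt (copy .tmp ;; put .out (some false))) (r, m)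
      (Stacks.get { s with out := E }) (none, m)
      (Stacks.get { s with out := List.replicate W.length (some false) ++ E, rt := [],
                           tmp := W.reverse.map some }) (4 * W.length + 2) := by
    refine Runs.scan_list W [] (fun _ => m) (fun l₁ => Stacks.get
      { s with out := List.replicate l₁.length (some false) ++ E,
               tmp := l₁.reverse.map some }) 2 rfl (by simp [hrt, htmp])
      (by simp) ?_ rfl (by simp)
    intro l₁ b l₂ _
    refine ⟨_, ((Runs.push ..).seq (Runs.push ..)).of_eq rfl ?_ le_rfl⟩
    simp [List.replicate_succ]
  have h₂ := Runs.copy_scan (ρ := Mem) (src := .tmp) (dst := .rt) (by decide) W.reverse []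
    (none, m) (Stacks.get { s with out := List.replicate W.length (some false) ++ E, rt := [],
                                   tmp := W.reverse.map some }) (by simp) (by simp)
  set F := some true :: (List.replicate W.length (some false) ++ E) with hF
  have h₃ : Runs (scan .l (copy .tmp ;;
      .push .out (fun v => v.1.bind fun s => s.bind fun b => ((k.out v.2.1 b)[0]?).map some) ;;
      .push .out (fun v => v.1.bind fun s => s.bind fun b => ((k.out v.2.1 b)[1]?).map some) ;;
      .push .out (fun v => v.1.bind fun s => s.bind fun b => ((k.out v.2.1 b)[2]?).map some) ;;
      .load (fun v => (v.1, (match v.1 with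
        | some (some b) => k.next v.2.1 b
        | _ => v.2.1, v.2.2))))) (none, (.init, m.2))
      (Stacks.get { s with out := F }) (none, (state k L, m.2))
      (Stacks.get { s with out := (output k .init L).reverse.map some ++ F, l := [],
                           tmp := L.reverse.map some }) (7 * L.length + 2) := by
    refine Runs.scan_list L [] (fun l₁ => (state k l₁, m.2)) (fun l₁ => Stacks.get
      { s with out := (output k .init l₁).reverse.map some ++ F,
               tmp := l₁.reverse.map some }) 5 rfl (by simp [hl, htmp, output])
      (by simp) ?_ rfl (by simp)
    intro l₁ b l₂ _
    refine ⟨some (some b), ((Runs.push ..).seq ((Runs.push ..).seq ((Runs.push ..).seq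
      ((Runs.push ..).seq (Runs.load ..))))).of_eq ?_ ?_ le_rfl⟩
    · simp [state]
    · have := push_three (k.out (state k l₁) b) (length_out_le ..)
        ((output k .init l₁).reverse.map some ++ F)
      simp [output_append] at this ⊢
      rw [this]
      rfl
  have h₄ := Runs.copy_scan (ρ := Mem) (src := .tmp) (dst := .l) (by decide) L.reverse []
    (none, (state k L, m.2))
    (Stacks.get { s with out := (k.final (state k L)).reverse.map some ++
      ((output k .init L).reverse.map some ++ F), l := [], tmp := L.reverse.map some })
    (by simp) (by simp)
  unfold emit
  refine Runs.of_eq ((Runs.push ..).seq ((Runs.push ..).seq ((Runs.push ..).andThen rfl ?_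
    (h₁.seq (h₂.seq ((Runs.push ..).seq ((Runs.load ..).andThen rfl ?_
      (h₃.seq ((Runs.push ..).seq ((Runs.push ..).andThen rfl ?_ h₄)))))))))) rfl ?_ ?_
  · cases k <;> simp [hE, Kind.extra]
  · simp [hF, hrt, htmp]
  · have := push_two (k.final (state k L)) (length_final_le ..)
      ((output k .init L).reverse.map some ++ F)
    simp at this ⊢
    rw [this]
  · have : (k.word W.length L).reverse.map some ++ none :: s.out =
        (k.final (state k L)).reverse.map some ++ ((output k .init L).reverse.map some ++ F) := by
      simp only [Kind.word, transduce_eq, state, List.reverse_cons, List.reverse_append,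
        List.map_append, List.reverse_replicate, List.map_replicate, List.append_assoc,
        List.map_cons, List.map_nil, F, E, List.cons_append, List.nil_append]
      rw [List.replicate_add, List.append_assoc]
    rw [this]
    simp [← hl, htmp]
  · simp
    omega

end QueryProg

namespace QueryProg

open Prog CountTree

theorem encodeBlocks_append (bs bs' : List (List Bool)) :
    encodeBlocks (bs ++ bs') = encodeBlocks bs ++ encodeBlocks bs' := by
  simp [encodeBlocks]

theorem encodeBlocks_singleton (b : List Bool) : encodeBlocks [b] = b.map some ++ [none] := by
  simp [encodeBlocks]

/-- Writes queries of several kinds. -/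
def emitAll : List Kind → Prog Reg Mem
  | [] => .load id
  | k :: ks => emitAll ks ;; emit k

theorem runs_emitAll (ks : List Kind) (r : Option (Option Bool)) (m : Mem) (W L : List Bool)
    (s : Stacks) (hrt : s.rt = W.map some) (hl : s.l = L.map some) (htmp : s.tmp = []) :
    ∃ r' q, Runs (emitAll ks) (r, m) s.get (r', (q, m.2))
      (Stacks.get { s with
        out := encodeBlocks (ks.map fun k => (k.word W.length L).reverse) ++ s.out })
      (ks.length * (20 * (W.length + L.length + 1)) + 1) := by
  induction ks with
  | nil => exact ⟨r, m.1, (Runs.load ..).of_eq rfl (by simp [encodeBlocks]) (by simp)⟩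
  | cons k ks ih =>
    obtain ⟨r', q, h⟩ := ih
    obtain ⟨q', h'⟩ := runs_emit k r' (q, m.2) W L { s with
      out := encodeBlocks (ks.map fun k => (k.word W.length L).reverse) ++ s.out } hrt hl htmp
    refine ⟨none, q', (h.seq h').of_eq rfl ?_ ?_⟩
    · simp [encodeBlocks]
    · simp only [List.length_cons]
      ring_nf
      rfl

/-- Writes all the queries of the walk. -/
def walkProg : Prog Reg Mem :=
  scan .l (copy .l ;; emitAll Kind.all ;; .pop .l ;; copy .rt ;;
    .load (fun v => (v.1, (.init, v.2.2))))

/-- The words of the last steps of a walk to a node of the given height, which start at the root. -/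
def revWords : List Bool → ℕ → List (List Bool)
  | [], _ => []
  | b :: L, m => revWords L (m + 1) ++ stepWords m (b :: L)

/-- The output is a stack and is filled from its end, so the program climbs from the leaf to the
root. The resulting order is still that of the walk. -/
theorem revWords_append (w L : List Bool) :
    revWords (w.reverse ++ L) 0 = revWords L w.length ++ walkWords L w := by
  induction w generalizing L with
  | nil => simp [walkWords]
  | cons b w ih => simp [walkWords, revWords, ih]

theorem runs_walkProg (L W : List Bool) (r : Option (Option Bool)) (c : Bool × Bool) (s : Stacks)
    (htmp : s.tmp = []) :
    Runs walkProg (r, (.init, c)) (Stacks.get { s with l := L.map some, rt := W.map some })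
      (none, (.init, c)) (Stacks.get { s with
        l := [], rt := (L.reverse ++ W).map some,
        out := encodeBlocks ((revWords L W.length).map List.reverse) ++ s.out })
      (L.length * (120 * (L.length + W.length + 1) + 8) + 2) := by
  induction L generalizing W r s with
  | nil => exact (Runs.scan_done (by simp)).of_eq (by simp) (by simp [revWords, encodeBlocks]) (by simp)
  | cons b L ih =>
    obtain ⟨r', q, h⟩ := runs_emitAll Kind.all (some (some b)) (.init, c) W (b :: L)
      { s with l := (b :: L).map some, rt := W.map some } rfl rfl htmp
    have hb : Runs (copy .l ;; emitAll Kind.all ;; .pop .l ;; copy .rt ;;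
        .load (fun v => (v.1, (.init, v.2.2)))) (some (some b), (.init, c))
        (Stacks.get { s with l := L.map some, rt := W.map some }) (some (some b), (.init, c))
        (Stacks.get { s with
          l := L.map some
          rt := (b :: W).map some
          out := encodeBlocks ((stepWords W.length (b :: L)).map List.reverse) ++ s.out })
        (120 * (L.length + W.length + 2) + 5) :=
      ((Runs.push ..).andThen (t := 1) rfl (by simp) (h.seq ((Runs.pop ..).seq ((Runs.push ..).seq
        (Runs.load ..))))).of_eq (by simp) (by simp [stepWords, comp_def])
          (by simp [Kind.all]; ring_nf; omega)
    unfold walkProg at ih ⊢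
    refine (Runs.scan_cons (b := b) (l := L.map some) (by simp)
      (by simpa using hb) (ih (b :: W) (some (some b))
        { s with out := encodeBlocks ((stepWords W.length (b :: L)).map List.reverse) ++ s.out }
        htmp)).of_eq rfl ?_ ?_
    · simp [revWords, encodeBlocks_append]
    · simp
      ring_nf
      omega

/-! ### Adding a power of two to a position -/

/-- The digits of `n + c` for the digits of `n`, least significant digit first. -/
def addCarry : Bool → List Bool → List Bool
  | c, [] => if c then [true] else []
  | c, b :: l => (b ^^ c) :: addCarry (b && c) l

theorem addCarry_bits (c : Bool) (n : ℕ) : addCarry c n.bits = (n + c.toNat).bits := by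
  induction n using Nat.binaryRec' generalizing c with
  | zero => cases c <;> simp [addCarry]
  | bit b n h ih =>
    have e : Nat.bit b n + c.toNat = Nat.bit (b ^^ c) (n + (b && c).toNat) := by
      cases b <;> cases c <;> simp [Nat.bit_val]
      omega
    rw [Nat.bits_append_bit n b h, addCarry, ih, e, Nat.bits_append_bit]
    cases b <;> cases c <;> simp at h ⊢
    exact h

/-- Adding `2 ^ k` keeps the `k` lowest digits, padded with zeros, and increments the number formed
by the others. Only canonical digits are involved, so no leading zeros arise. -/
theorem takeD_append_addCarry (k n : ℕ) :
    n.bits.takeD k false ++ addCarry true (n.bits.drop k) = (n + 2 ^ k).bits := by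
  induction k generalizing n with
  | zero => simpa using addCarry_bits true n
  | succ k ih =>
    induction n using Nat.binaryRec' with
    | zero =>
      have := ih 0
      simp only [Nat.zero_bits, List.drop_nil, zero_add] at this ⊢
      have e : 2 ^ (k + 1) = Nat.bit false (2 ^ k) := by simp [Nat.bit_val, pow_succ, mul_comm]
      rw [e, Nat.bits_append_bit _ _ (by simp), ← this]
      simp
    | bit b n h =>
      have e : Nat.bit b n + 2 ^ (k + 1) = Nat.bit b (n + 2 ^ k) := by
        simp [Nat.bit_val, pow_succ]; ring
      rw [e, Nat.bits_append_bit n b h, Nat.bits_append_bit _ _ (by simp), ← ih]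
      simp

theorem length_addCarry_le (c : Bool) (l : List Bool) : (addCarry c l).length ≤ l.length + 1 := by
  induction l generalizing c with
  | nil => cases c <;> simp [addCarry]
  | cons b l ih => simpa [addCarry] using ih _

/-- Adds one to the number on the stack `z` if the carry is set, writing to the stack `w`. -/
def addProg : Prog Reg Mem :=
  scan .z (.push .w (fun v => v.1.map fun s => s.map fun b => b ^^ v.2.2.1) ;;
    .load (fun v => (v.1, (v.2.1, (v.1.any fun s => s.any fun b => b && v.2.2.1), v.2.2.2))))

/-- The last carry `c'` remains in the memory; `shiftBlock` turns it into a digit afterwards. -/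
theorem runs_addProg (l : List Bool) (r : Option (Option Bool)) (q : Scan) (c f : Bool)
    (s : Stacks) : ∃ c' l', addCarry c l = l' ++ (if c' then [true] else []) ∧
      Runs addProg (r, (q, c, f)) (Stacks.get { s with z := l.map some }) (none, (q, c', f))
        (Stacks.get { s with z := [], w := l'.reverse.map some ++ s.w }) (4 * l.length + 2) := by
  induction l generalizing r c s with
  | nil =>
    exact ⟨c, [], rfl, (Runs.scan_done (by simp)).of_eq (by simp) (by simp) (by simp)⟩
  | cons b l ih =>
    obtain ⟨c', l', h, h'⟩ := ih (some (some b)) (b && c) { s with w := some (b ^^ c) :: s.w }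
    refine ⟨c', (b ^^ c) :: l', by simp [addCarry, h], ?_⟩
    unfold addProg at h' ⊢
    refine (Runs.scan_cons (b := b) (l := l.map some) (by simp)
      (((Runs.push ..).seq (Runs.load ..)).of_eq rfl ?_ le_rfl) h').of_eq rfl ?_ ?_
    · simp
    · simp
    · simp
      omega

/-- Moves a block from the stack `x` to the output and adds to it a power of two, whose exponent is
the number of bits on the counter. -/
def shiftBlock : Prog Reg Mem :=
  scan .x (copy .z) ;; .load (fun v => (v.1, (v.2.1, true, decide (v.1 = some none)))) ;;
    put .out none ;;
    scan .cnt (copy .tmp ;; .pop .z ;;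
      .push .w (fun v => some (some (v.1.any fun s => s.any id)))) ;;
    scan .tmp (copy .cnt) ;; addProg ;;
    .push .w (fun v => if v.2.2.1 then some (some true) else none) ;;
    scan .w (copy .out) ;;
    .load (fun v => (if v.2.2.2 then some none else none, (v.2.1, false, false)))

theorem takeD_succ (l : List Bool) (n : ℕ) :
    l.takeD (n + 1) false = l.takeD n false ++ [l.getD n false] := by
  induction n generalizing l with
  | zero => cases l <;> rfl
  | succ n ih =>
    rw [List.takeD_succ, ih, List.takeD_succ]
    cases l <;> simp

theorem runs_shiftBlock (n k : ℕ) (X : List (Option Bool)) (hX : ∀ b, X.head? ≠ some (some b))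
    (r : Option (Option Bool)) (q : Scan) (s : Stacks) (hz : s.z = []) (hw : s.w = [])
    (htmp : s.tmp = []) (hcnt : s.cnt = List.replicate k (some false)) :
    Runs shiftBlock (r, (q, false, false))
      (Stacks.get { s with x := n.bits.reverse.map some ++ X }) (X.head?, (q, false, false))
      (Stacks.get { s with x := X.tail, out := (n + 2 ^ k).bits.map some ++ none :: s.out })
      (20 * (n.bits.length + k + 1)) := by
  have h₁ := Runs.copy_scan (src := .x) (dst := .z) (by decide) n.bits.reverse X
    (r, (q, false, false)) (Stacks.get { s with x := n.bits.reverse.map some ++ X }) (by simp) hX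
  -- The flag records whether another block follows. The register that showed it is overwritten
  -- meanwhile and is restored from the flag for the test of the loop.
  set f := decide (X.head? = some none) with hf
  have h₂ : Runs (scan .cnt (copy .tmp ;; .pop .z ;;
      .push .w (fun v => some (some (v.1.any fun s => s.any id))))) (X.head?, (q, true, f))
      (Stacks.get { s with x := X.tail, z := n.bits.map some, out := none :: s.out })
      (none, (q, true, f))
      (Stacks.get { s with
        x := X.tail, z := (n.bits.drop k).map some, out := none :: s.out,
        cnt := [], tmp := List.replicate k (some false),
        w := (n.bits.takeD k false).reverse.map some }) (5 * k + 2) := by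
    refine (Runs.scan_list (List.replicate k false) [] (fun _ => (q, true, f))
      (fun l₁ => Stacks.get { s with
        x := X.tail, z := (n.bits.drop l₁.length).map some,
        out := none :: s.out, tmp := l₁.reverse.map some,
        w := (n.bits.takeD l₁.length false).reverse.map some }) 3 rfl (by simp [hcnt, htmp, hw])
      (by simp) ?_ rfl rfl).of_eq rfl (by simp) (by simp)
    intro l₁ b l₂ _
    refine ⟨_, ((Runs.push ..).seq ((Runs.pop ..).seq (Runs.push ..))).of_eq rfl ?_ le_rfl⟩
    rw [List.length_append, List.length_singleton, takeD_succ]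
    have : (Option.any (fun s => Option.any id s) ((n.bits.drop l₁.length).map some).head?) =
        n.bits.getD l₁.length false := by
      rw [List.head?_map, List.head?_drop, List.getD_eq_getElem?_getD]
      cases n.bits[l₁.length]? <;> simp
    simp at this ⊢
    simp [this]
  have h₃ := Runs.copy_scan (src := .tmp) (dst := .cnt) (by decide) (List.replicate k false) []
    (none, (q, true, f)) (Stacks.get { s with
      x := X.tail, z := (n.bits.drop k).map some, out := none :: s.out, cnt := [],
      tmp := List.replicate k (some false), w := (n.bits.takeD k false).reverse.map some })
    (by simp) (by simp)
  obtain ⟨c', l', hl', h₄⟩ := runs_addProg (n.bits.drop k) none q true f { s with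
      x := X.tail, out := none :: s.out, w := (n.bits.takeD k false).reverse.map some }
  have hadd := takeD_append_addCarry k n
  rw [hl'] at hadd
  have h₅ := Runs.copy_scan (src := .w) (dst := .out) (by decide) (n + 2 ^ k).bits.reverse []
    (none, (q, c', f)) (Stacks.get { s with
      x := X.tail, z := [], out := none :: s.out, w := (n + 2 ^ k).bits.reverse.map some })
    (by simp) (by simp)
  have hlen : (n + 2 ^ k).bits.length ≤ n.bits.length + k + 1 := by
    have := length_addCarry_le true (n.bits.drop k)
    rw [← takeD_append_addCarry, List.length_append, List.takeD_length]
    simp only [List.length_drop] at this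
    omega
  unfold shiftBlock
  refine Runs.of_eq (h₁.seq ((Runs.load ..).seq ((Runs.push ..).andThen rfl ?_ (h₂.seq
    (h₃.andThen rfl ?_ (h₄.seq ((Runs.push ..).andThen rfl ?_ (h₅.seq (Runs.load ..)))))))))
    ?_ ?_ ?_
  · simp [hz]
  · simp [hcnt, htmp]
  · rw [← hadd]
    cases c' <;> simp
  · simp only [hf]
    rcases X with _ | ⟨_ | b, X⟩
    · simp
    · simp
    · simp at hX
  · simp [hz, hw]
  · simp
    omega

end QueryProg

/-! ### The complete list of queries -/

namespace QueryProg

open Prog CountTree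

/-- Moves all blocks from the stack `x` to the output, adding a power of two to each. -/
def shiftProg : Prog Reg Mem := .pop .x ;; .loop (fun v => decide (v.1 = some none)) shiftBlock

/-- Below each block on the reversed stack lies a separator or nothing, so the scan of a block stops
at its end. -/
theorem head?_reverse_encodeBlocks (bs : List (List Bool)) (b : Bool) :
    (encodeBlocks bs).reverse.head? ≠ some (some b) := by
  rcases List.eq_nil_or_concat bs with rfl | ⟨bs, c, rfl⟩
  · simp [encodeBlocks]
  · simp [encodeBlocks_append, encodeBlocks_singleton]

theorem runs_loop_shiftBlock (ns : List ℕ) (k : ℕ) (q : Scan) (s : Stacks) (hz : s.z = [])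
    (hw : s.w = []) (htmp : s.tmp = []) (hcnt : s.cnt = List.replicate k (some false)) :
    Runs (.loop (fun v => decide (v.1 = some none)) shiftBlock)
      ((encodeBlocks (ns.map Nat.bits)).reverse.head?, (q, false, false))
      (Stacks.get { s with x := (encodeBlocks (ns.map Nat.bits)).reverse.tail })
      (none, (q, false, false))
      (Stacks.get { s with
        x := [], out := encodeBlocks ((ns.map (· + 2 ^ k)).map Nat.bits) ++ s.out })
      ((encodeBlocks (ns.map Nat.bits)).length * (20 * k + 21) + 1) := by
  induction ns using List.reverseRecOn generalizing s with
  | nil =>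
    exact (Runs.loop_done rfl).of_eq rfl (by simp [encodeBlocks]) (by simp)
  | append_singleton ns n ih =>
    have h := runs_shiftBlock n k (encodeBlocks (ns.map Nat.bits)).reverse
      (head?_reverse_encodeBlocks _) (some none) q s hz hw htmp hcnt
    have h' := ih { s with out := (n + 2 ^ k).bits.map some ++ none :: s.out } hz hw htmp hcnt
    rw [List.map_append, List.map_cons, List.map_nil, encodeBlocks_append, encodeBlocks_singleton]
    refine (Runs.loop_step (by simp) (by simpa using h) h').of_eq rfl ?_ ?_
    · simp [encodeBlocks_append, encodeBlocks_singleton]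
    · simp
      ring_nf
      nlinarith [Nat.zero_le (k * n.bits.length)]

/-- The queries of the walk, and those of the original verifier behind all bits of the tree. -/
def queries (R : List Bool) (l : List ℕ) : List ℕ :=
  (walkWords [] R).map ofBits ++ l.map (· + 2 ^ (R.length + 3))

/-- Writes the queries. -/
def post : Prog Reg Mem :=
  shiftProg ;; walkProg ;; drain .rt ;; drain .cnt

theorem map_bits_walkWords (R : List Bool) :
    ((walkWords [] R).map ofBits).map Nat.bits = (walkWords [] R).map List.reverse := by
  have : ∀ L, ∀ u ∈ walkWords L R, ∃ v, u = true :: v := by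
    induction R with
    | nil => simp [walkWords]
    | cons b R ih =>
      intro L u hu
      rcases List.mem_append.mp hu with hu | hu
      · obtain ⟨k, -, rfl⟩ := List.mem_map.mp hu
        exact ⟨_, rfl⟩
      · exact ih _ u hu
  rw [List.map_map]
  refine List.map_congr_left fun u hu => ?_
  obtain ⟨v, rfl⟩ := this [] u hu
  exact bits_ofBits v

theorem runs_post (R : List Bool) (ns : List ℕ) :
    Runs post (none, (.init, false, false))
      (Stacks.get { x := (encodeBlocks (ns.map Nat.bits)).reverse, l := R.reverse.map some,
                    cnt := List.replicate (R.length + 3) (some false) })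
      (none, (.init, false, false))
      (Stacks.get { out := encodeBlocks ((queries R ns).map Nat.bits) })
      ((encodeBlocks (ns.map Nat.bits)).length * (20 * (R.length + 3) + 21) +
        R.length * (120 * (R.length + 1) + 8) + 6 * R.length + 30) := by
  have h₁ := runs_loop_shiftBlock ns (R.length + 3) .init
    { l := R.reverse.map some, cnt := List.replicate (R.length + 3) (some false) } rfl rfl rfl rfl
  have h₂ := runs_walkProg R.reverse [] none (false, false)
    { cnt := List.replicate (R.length + 3) (some false),
      out := encodeBlocks ((ns.map (· + 2 ^ (R.length + 3))).map Nat.bits) } rfl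
  have h₃ := Runs.drain (ρ := Mem) .rt R (none, (.init, false, false)) (Stacks.get
    { rt := R.map some, cnt := List.replicate (R.length + 3) (some false),
      out := encodeBlocks ((queries R ns).map Nat.bits) }) rfl
  have h₄ := Runs.drain (ρ := Mem) .cnt (List.replicate (R.length + 3) false)
    (none, (.init, false, false)) (Stacks.get
      { cnt := List.replicate (R.length + 3) (some false),
        out := encodeBlocks ((queries R ns).map Nat.bits) }) (by simp)
  have e := revWords_append R []
  simp only [revWords, List.append_nil, List.nil_append] at e
  unfold post shiftProg
  refine Runs.of_eq (((Runs.pop ..).andThen rfl ?_ h₁).andThen rfl ?_ (h₂.andThen rfl ?_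
    (h₃.andThen rfl ?_ h₄))) rfl ?_ ?_
  · simp
  · simp
  · simp [queries, e, encodeBlocks_append, ← map_bits_walkWords]
  · simp
  · simp
  · simp
    ring_nf
    omega

theorem polyTime_queries {f : List Bool × List Bool → List ℕ}
    (hf : PolyTime (fun p : List Bool × List Bool => encodeBlocks [p.1, p.2])
      (fun l : List ℕ => encodeBlocks (l.map Nat.bits)) f) :
    PolyTime (fun p : List Bool × List Bool => encodeBlocks [p.1, p.2])
      (fun l : List ℕ => encodeBlocks (l.map Nat.bits)) fun p => queries p.2 (f p) := by
  -- The time is quadratic: each coin causes six addresses of linear length, and each old position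
  -- is shifted with the help of a counter of linear length. The factor 300 is generous.
  refine PolyTime.wrap hf Reg.inp Reg.x Reg.out (none, (Scan.init, false, false)) pre post id
    (fun _ => (Scan.init, false, false)) (fun p => Stacks.get
      { l := p.2.reverse.map some, cnt := List.replicate (p.2.length + 3) (some false) })
    300 2 (fun _ => le_rfl) (fun p => ⟨some none, ?_⟩) (fun p => ?_)
  · refine (Runs.of_eq (S := update (fun _ => []) Reg.inp _)
      (by simpa [Stacks.empty_eq] using runs_pre p.1 p.2 (.init, false, false)) rfl ?_ ?_)
    · simp
    · simp [encodeBlocks]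
      nlinarith
  · refine Runs.of_eq (by simpa using runs_post p.2 (f p)) rfl ?_ ?_
    · simp [Stacks.empty_eq]
    · rw [id_eq, show (encodeBlocks [p.1, p.2]).length = p.1.length + p.2.length + 2 by
        simp [encodeBlocks]; ring]
      generalize (encodeBlocks ((f p).map Nat.bits)).length = m
      generalize p.1.length = x
      generalize p.2.length = y
      refine le_trans ?_ (Nat.mul_le_mul_left _ (Nat.pow_le_pow_left
        (show y + m + 3 ≤ x + y + 2 + m + 1 by omega) 2))
      nlinarith [Nat.zero_le (y * m)]

end QueryProg

/-! ### The program that checks the bits read -/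

namespace CountTree

variable (a : ℕ) {q : ℕ}

theorem walk_append (s : WalkState q) (w w' A : List Bool) :
    walk a s (w ++ w') A = walk a (walk a s w A).1 w' (walk a s w A).2 := by
  induction w generalizing s A with
  | nil => rfl
  | cons b w ih => simp [walk, ih]

theorem length_walk_le (s : WalkState q) (w A : List Bool) :
    (walk a s w A).2.length ≤ A.length := by
  induction w generalizing s A with
  | nil => exact le_rfl
  | cons b w ih => exact (ih _ _).trans (by simp)

end CountTree

namespace DecideProg

open Prog CountTree

variable {a q : ℕ}

/-- The memory: the state of the automaton, the bits read in a step, and the bit of the path. -/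
abbrev Mem (q : ℕ) : Type := WalkState q × (Fin 6 → Bool) × Bool

/-- The memory between the steps. -/
abbrev mem (s : WalkState q) : Mem q := (s, fun _ => false, false)

/-- Reads a bit of the proof. -/
def read (i : Fin 6) : Prog Reg (Mem q) :=
  .pop .inp ;; .push .inp (fun v => if v.1 = some none then some none else none) ;;
    .load (fun v => (v.1, (v.2.1, update v.2.2.1 i (decide (v.1 = some (some true))), v.2.2.2)))

/-- A separator is pushed back, so an exhausted list yields `false` again and again, in agreement
with `readBit`. The decision has to be computed on answer lists of any length. -/
theorem runs_read (i : Fin 6) (r : Option (Option Bool)) (m : Mem q) (A : List Bool) (s : Stacks)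
    (hs : s.inp = A.map some ++ [none]) :
    ∃ r', Runs (read i) (r, m) s.get (r', (m.1, update m.2.1 i (readBit A), m.2.2))
      (Stacks.get { s with inp := (A.drop 1).map some ++ [none] }) 3 := by
  refine ⟨some A.head?, Runs.of_eq ((Runs.pop ..).seq ((Runs.push ..).seq (Runs.load ..))) ?_ ?_
    le_rfl⟩
  · rcases A with _ | ⟨b, A⟩ <;> simp [hs]
  · rcases A with _ | ⟨b, A⟩ <;> simp [hs]

/-- Reads the bits of a step and makes this step. -/
def stepProg (a : ℕ) : Prog Reg (Mem q) :=
  .load (fun v => (v.1, (v.2.1, v.2.2.1, decide (v.1 = some (some true))))) ;;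
    read 0 ;; read 1 ;; read 2 ;; read 3 ;; read 4 ;; read 5 ;;
    .load (fun v => (v.1, (v.2.1.step a v.2.2.2 v.2.2.1, fun _ => false, false)))

theorem runs_stepProg (b : Bool) (st : WalkState q) (A : List Bool) (s : Stacks)
    (hs : s.inp = A.map some ++ [none]) :
    ∃ r, Runs (stepProg a) (some (some b), (st, fun _ => false, false)) s.get
      (r, ((walk a st [b] A).1, fun _ => false, false))
      (Stacks.get { s with inp := (walk a st [b] A).2.map some ++ [none] }) 20 := by
  obtain ⟨r₀, h₀⟩ := runs_read 0 (some (some b)) (st, fun _ => false, b) A s hs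
  obtain ⟨r₁, h₁⟩ := runs_read 1 r₀ (st, _, b) (A.drop 1) { s with inp := _ } rfl
  obtain ⟨r₂, h₂⟩ := runs_read 2 r₁ (st, _, b) (A.drop 2) { s with inp := _ } rfl
  obtain ⟨r₃, h₃⟩ := runs_read 3 r₂ (st, _, b) (A.drop 3) { s with inp := _ } rfl
  obtain ⟨r₄, h₄⟩ := runs_read 4 r₃ (st, _, b) (A.drop 4) { s with inp := _ } rfl
  obtain ⟨r₅, h₅⟩ := runs_read 5 r₄ (st, _, b) (A.drop 5) { s with inp := _ } rfl
  refine ⟨r₅, Runs.of_eq ((Runs.load ..).andThen ?_ rfl (h₀.seq (h₁.andThen rfl ?_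
    (h₂.andThen rfl ?_ (h₃.andThen rfl ?_ (h₄.andThen rfl ?_ (h₅.seq (Runs.load ..)))))))) ?_ ?_
    (by norm_num)⟩
  · cases b <;> rfl
  iterate 4 · simp
  · simp only [walk]
    congr 3
    funext i
    fin_cases i <;> simp [update]
  · simp [walk]

/-- Moves the input to the stack `x` without the bits that the walk reads, and makes the walk. -/
def pre (a : ℕ) : Prog Reg (Mem q) :=
  scan .inp (copy .x) ;; put .x none ;; scan .inp (copy .x ;; copy .l) ;; put .x none ;;
    scan .l (copy .rt) ;; scan .rt (stepProg a) ;; scan .inp (copy .x) ;; put .x none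

theorem runs_pre (x R A : List Bool) :
    Runs (pre a) (none, mem (WalkState.init (q := q)))
      (Stacks.get { inp := encodeBlocks [x, R, A] })
      (some none, mem (walk a (WalkState.init (q := q)) R A).1)
      (Stacks.get { x := (encodeBlocks [x, R, (walk a (WalkState.init (q := q)) R A).2]).reverse })
      (30 * (x.length + R.length + A.length + 1)) := by
  have h₁ := Runs.copy_scan (ρ := Mem q) (src := .inp) (dst := .x) (by decide) x
    (none :: (encodeBlocks [R, A])) (none, mem (WalkState.init (q := q)))
    (Stacks.get { inp := encodeBlocks [x, R, A] })
    (by simp [encodeBlocks]) (by simp)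
  have h₂ : Runs (scan .inp (copy .x ;; copy .l))
      (some none, mem (WalkState.init (q := q)))
      (Stacks.get { inp := encodeBlocks [R, A], x := none :: x.reverse.map some })
      (some none, mem (WalkState.init (q := q)))
      (Stacks.get { inp := encodeBlocks [A],
                    x := R.reverse.map some ++ none :: x.reverse.map some,
                    l := R.reverse.map some }) (4 * R.length + 2) := by
    refine Runs.scan_list R (none :: encodeBlocks [A])
      (fun _ => mem (WalkState.init (q := q))) (fun l₁ => Stacks.get
      { x := l₁.reverse.map some ++ none :: x.reverse.map some, l := l₁.reverse.map some })
      2 rfl (by simp [encodeBlocks]) (by simp) ?_ rfl (by simp)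
    intro l₁ b l₂ _
    refine ⟨_, ((Runs.push ..).seq (Runs.push ..)).of_eq rfl ?_ le_rfl⟩
    simp
  have h₃ := Runs.copy_scan (ρ := Mem q) (src := .l) (dst := .rt) (by decide) R.reverse []
    (some none, mem (WalkState.init (q := q)))
    (Stacks.get { inp := encodeBlocks [A],
                  x := none :: (R.reverse.map some ++ none :: x.reverse.map some),
                  l := R.reverse.map some }) (by simp) (by simp)
  have h₄ : Runs (scan .rt (stepProg a))
      (none, mem (WalkState.init (q := q)))
      (Stacks.get { inp := encodeBlocks [A], rt := R.map some,
                    x := none :: (R.reverse.map some ++ none :: x.reverse.map some) })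
      (none, mem (walk a (WalkState.init (q := q)) R A).1)
      (Stacks.get { inp := encodeBlocks [(walk a (WalkState.init (q := q)) R A).2],
                    x := none :: (R.reverse.map some ++ none :: x.reverse.map some) })
      (22 * R.length + 2) := by
    refine Runs.scan_list R []
      (fun l₁ => mem (walk a (WalkState.init (q := q)) l₁ A).1)
      (fun l₁ => Stacks.get
        { inp := encodeBlocks [(walk a (WalkState.init (q := q)) l₁ A).2],
          x := none :: (R.reverse.map some ++ none :: x.reverse.map some) })
      20 rfl (by simp [walk]) (by simp) ?_ rfl (by simp)
    intro l₁ b l₂ _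
    obtain ⟨r, h⟩ := runs_stepProg (a := a) b (walk a (WalkState.init (q := q)) l₁ A).1
      (walk a (WalkState.init (q := q)) l₁ A).2
      { inp := encodeBlocks [(walk a (WalkState.init (q := q)) l₁ A).2], rt := l₂.map some,
        x := none :: (R.reverse.map some ++ none :: x.reverse.map some) } (by simp [encodeBlocks])
    refine ⟨r, ?_⟩
    rw [walk_append]
    simpa [encodeBlocks] using h
  have h₅ := Runs.copy_scan (ρ := Mem q) (src := .inp) (dst := .x) (by decide)
    (walk a (WalkState.init (q := q)) R A).2 [none]
    (none, mem (walk a (WalkState.init (q := q)) R A).1)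
    (Stacks.get { inp := encodeBlocks [(walk a (WalkState.init (q := q)) R A).2],
                  x := none :: (R.reverse.map some ++ none :: x.reverse.map some) })
    (by simp [encodeBlocks]) (by simp)
  have hlen := length_walk_le a (WalkState.init (q := q)) R A
  unfold pre
  refine Runs.of_eq (h₁.seq ((Runs.push ..).andThen rfl ?_ (h₂.seq ((Runs.push ..).andThen rfl ?_
    (h₃.andThen rfl ?_ (h₄.seq (h₅.seq (Runs.push ..)))))))) rfl ?_ ?_
  · simp
  · simp
  · simp
  · simp [encodeBlocks]
  · simp
    omega

/-- Decides, when the decision of the original verifier is on the stack `x`. -/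
def post : Prog Reg (Mem q) :=
  .pop .x ;; .push .out (fun v => some (some (v.2.1.decide (decide (v.1 = some (some true)))))) ;;
    .load (fun _ => (none, mem (WalkState.init (q := q))))

theorem polyTime_decide {f : List Bool × List Bool × List Bool → Bool}
    (hf : PolyTime (fun p : List Bool × List Bool × List Bool => encodeBlocks [p.1, p.2.1, p.2.2])
      (fun b : Bool => [some b]) f) (a q : ℕ) :
    PolyTime (fun p : List Bool × List Bool × List Bool => encodeBlocks [p.1, p.2.1, p.2.2])
      (fun b : Bool => [some b]) fun p =>
        (walk a (WalkState.init (q := q)) p.2.1 p.2.2).1.decide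
          (f (p.1, p.2.1, (walk a (WalkState.init (q := q)) p.2.1 p.2.2).2)) := by
  refine PolyTime.wrap hf Reg.inp Reg.x Reg.out
    (none, mem (WalkState.init (q := q))) (pre a) post
    (fun p => (p.1, p.2.1, (walk a (WalkState.init (q := q)) p.2.1 p.2.2).2))
    (fun p => mem (walk a (WalkState.init (q := q)) p.2.1 p.2.2).1)
    (fun _ => Stacks.get {}) 30 1 (fun p => ?_) (fun p => ⟨some none, ?_⟩) (fun p => ?_)
  -- The old verifier receives only the answers that the walk has left, so its input is no longer
  -- than the given one.
  · have := length_walk_le a (WalkState.init (q := q)) p.2.1 p.2.2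
    simpa [encodeBlocks] using this
  · refine Runs.of_eq (S := update (fun _ => []) Reg.inp _)
      (by simpa [Stacks.empty_eq] using runs_pre p.1 p.2.1 p.2.2) rfl ?_ ?_
    · simp
    · simp [encodeBlocks]
      omega
  · refine Runs.of_eq ((Runs.pop ..).seq ((Runs.push ..).seq (Runs.load ..))) rfl ?_ ?_
    · simp [Stacks.empty_eq]
    · simp
      omega

end DecideProg

/-! ### The verifier -/

namespace CountTree

theorem exists_run (b : Bool) (L : List Bool) :
    ∃ t S, L = List.replicate t b ++ S ∧ S.head? ≠ some b := by
  induction L with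
  | nil => exact ⟨0, [], rfl, by simp⟩
  | cons c L ih =>
    by_cases h : c = b
    · obtain ⟨t, S, rfl, hS⟩ := ih
      exact ⟨t + 1, S, by rw [h]; rfl, hS⟩
    · exact ⟨0, c :: L, rfl, by simpa using h⟩

theorem Kind.exists_word_eq (k : Kind) (m : ℕ) (b : Bool) (L : List Bool) :
    ∃ m' j S, k.word m (b :: L) = address m' j S ∧ m' + j + S.length = m + (L.length + 1) := by
  obtain ⟨t, S, rfl, hS⟩ := exists_run b L
  have e : b :: (List.replicate t b ++ S) = List.replicate (t + 1) b ++ S := rfl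
  cases k with
  | last => exact ⟨_, _, _, word_last .., by simp; omega⟩
  | here => exact ⟨_, _, _, word_here .., by simp⟩
  | root => exact ⟨_, _, _, word_root .., by simp⟩
  | start => exact ⟨_, _, _, e ▸ word_start m t b S hS, by simp; omega⟩
  | child d => exact ⟨_, _, _, e ▸ word_child d m t b S hS, by simp; omega⟩

theorem exists_address_of_mem_walkWords {L w u : List Bool} (h : u ∈ walkWords L w) :
    ∃ m j S, u = address m j S ∧ m + j + S.length = L.length + w.length := by
  induction w generalizing L with
  | nil => simp [walkWords] at h
  | cons b w ih =>
    rcases List.mem_append.mp h with h | h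
    · obtain ⟨k, -, rfl⟩ := List.mem_map.mp h
      obtain ⟨m, j, S, h₁, h₂⟩ := k.exists_word_eq w.length b L
      exact ⟨m, j, S, h₁, by simp; omega⟩
    · obtain ⟨m, j, S, h₁, h₂⟩ := ih h
      exact ⟨m, j, S, h₁, by simp at h₂ ⊢; omega⟩

/-- For every bit read, the indices `m`, `j` and the length of the node add up to the height of the
tree; with the three symbols `true` of an address this makes `w.length + 3` digits. -/
theorem ofBits_lt_of_mem_walkWords {w u : List Bool} (h : u ∈ walkWords [] w) :
    ofBits u < 2 ^ (w.length + 3) := by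
  obtain ⟨m, j, S, rfl, hm⟩ := exists_address_of_mem_walkWords h
  have := ofBits_lt (address m j S)
  rwa [length_address, hm, List.length_nil, zero_add] at this

end CountTree

namespace Verifier

open CountTree

/-- The verifier that in addition checks a tree of counters at the beginning of the proof, whose
root claims that the original verifier accepts with probability at least `a / q`. -/
noncomputable def withTree (V : Verifier) (a q : ℕ) : Verifier where
  coins := V.coins
  query x R := QueryProg.queries R (V.query x R)
  decide x R A := (walk a (WalkState.init (q := q)) R A).1.decide
    (V.decide x R (walk a (WalkState.init (q := q)) R A).2)
  coins_polyTime := V.coins_polyTime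
  query_polyTime := QueryProg.polyTime_queries V.query_polyTime
  decide_polyTime := DecideProg.polyTime_decide V.decide_polyTime a q

variable (V : Verifier) {a q : ℕ} (π : ℕ → Bool) (x : List Bool)

theorem Restricted.withTree {V : Verifier} {r t : ℕ → ℕ} (h : V.Restricted r t) (a q : ℕ) :
    (V.withTree a q).Restricted r fun n => t n + 8 * r n := by
  refine fun x => ⟨(h x).1, fun R => ?_⟩
  have h₁ := (h x).1
  have h₂ := (h x).2 R
  change (QueryProg.queries _ _).length ≤ _
  rw [QueryProg.queries, List.length_append, List.length_map, List.length_map, length_walkWords,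
    List.length_ofFn]
  change 6 * V.coins x + (V.query x (List.ofFn (n := V.coins x) R)).length ≤ t x.length + 8 * r x.length
  omega

theorem HasProofLength.withTree {V : Verifier} {ℓ r t : ℕ → ℕ} (hV : V.HasProofLength ℓ)
    (h : V.Restricted r t) (a q : ℕ) :
    (V.withTree a q).HasProofLength fun n => ℓ n + 8 * 2 ^ r n := by
  intro x R i hi
  have h₁ : 2 ^ V.coins x ≤ 2 ^ r x.length := Nat.pow_le_pow_right two_pos (h x).1
  have hR : (List.ofFn R).length = V.coins x := List.length_ofFn
  have e : 2 ^ (V.coins x + 3) = 8 * 2 ^ V.coins x := by ring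
  rcases List.mem_append.mp hi with hi | hi
  · obtain ⟨u, hu, rfl⟩ := List.mem_map.mp hi
    have := ofBits_lt_of_mem_walkWords hu
    rw [hR, e] at this
    dsimp only
    omega
  · obtain ⟨i, hi', rfl⟩ := List.mem_map.mp hi
    have := hV x R i hi'
    dsimp only
    rw [hR, e]
    omega

theorem acceptProb_eq (V : Verifier) (π : ℕ → Bool) (x : List Bool)
    [DecidablePred (V.Accepts π x)] : V.acceptProb π x =
      countWords (fun w => Decidable.decide (V.Accepts π x w)) (V.coins x) / 2 ^ V.coins x := by
  rw [acceptProb, countWords.card_eq]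

instance (V : Verifier) (π : ℕ → Bool) (x : List Bool) : DecidablePred (V.Accepts π x) :=
  fun _ => inferInstanceAs (Decidable (_ = true))

/-- The decision of the original verifier at a leaf, where the original proof begins at
position `p`. -/
def leaf (p : ℕ) (L : List Bool) : Bool :=
  Decidable.decide (V.Accepts (fun i => π (i + p)) x L.reverse)

/-- The bits of the tree that are part of the proof. -/
def treeBits (m j : ℕ) (S : List Bool) : Bool := π (ofBits (address m j S))

/-- Without coins there is no walk, and the automaton in its initial state passes on the decision of
the old verifier. -/
theorem accepts_withTree_nil :
    (V.withTree a q).Accepts π x [] ↔ V.Accepts (fun i => π (i + 2 ^ 3)) x [] := by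
  simp [Accepts, withTree, QueryProg.queries, walkWords, walk, WalkState.decide, WalkState.init,
    comp_def]

theorem accepts_withTree_iff (hq : 0 < q) {R : List Bool} (hR : R ≠ []) :
    (V.withTree a q).Accepts π x R ↔
      passes (treeBits π) (V.leaf π x (2 ^ (R.length + 3))) [] true 0
          (-(treeBits π R.length 0 []).toNat) R = true ∧
        (a : ℤ) * 2 ^ R.length ≤ q * claim (treeBits π) [] R.length := by
  obtain ⟨h₁, h₂⟩ := decide_walk_init a (treeBits π) (V.leaf π x (2 ^ (R.length + 3))) π
    (fun _ _ _ => rfl) hq ((V.query x R).map fun i => π (i + 2 ^ (R.length + 3))) R hR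
  rw [← h₂]
  have e : (QueryProg.queries R (V.query x R)).map π =
      (walkWords [] R).map (fun u => π (ofBits u)) ++
        (V.query x R).map fun i => π (i + 2 ^ (R.length + 3)) := by
    simp [QueryProg.queries, comp_def]
  have e' : V.leaf π x (2 ^ (R.length + 3)) R.reverse =
      V.decide x R ((V.query x R).map fun i => π (i + 2 ^ (R.length + 3))) := by
    simp [leaf, Accepts]
  change (WalkState.decide (walk a _ R ((QueryProg.queries R (V.query x R)).map π)).1
    (V.decide x R (walk a _ R ((QueryProg.queries R (V.query x R)).map π)).2)) = true ↔ _
  rw [e, e', h₁]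

theorem acceptProb_withTree_of_coins_eq_zero (h : V.coins x = 0) :
    (V.withTree a q).acceptProb π x = V.acceptProb (fun i => π (i + 2 ^ 3)) x := by
  rw [acceptProb_eq, acceptProb_eq]
  change (countWords _ (V.coins x) : ℝ) / 2 ^ V.coins x = _
  simp [h, countWords, accepts_withTree_nil]

/-- The soundness of the verifier. -/
theorem acceptProb_withTree_le (hq : 0 < q) {s : ℝ} (hs : s < a / q) (ha : (a / q : ℝ) < 1)
    (h : ∀ π', V.acceptProb π' x ≤ s) :
    (V.withTree a q).acceptProb π x ≤ 1 - (a / q - s) / 6 := by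
  rcases Nat.eq_zero_or_pos (V.coins x) with h0 | h0
  · rw [acceptProb_withTree_of_coins_eq_zero V π x h0]
    exact (h _).trans (by linarith)
  set r := V.coins x with hr
  have hpow : (0 : ℝ) < 2 ^ r := by positivity
  have hq' : (0 : ℝ) < q := by exact_mod_cast hq
  rw [acceptProb_eq, div_le_iff₀ (by positivity)]
  change (countWords _ r : ℝ) ≤ _ * 2 ^ r
  have hacc : ∀ w : List Bool, w.length = r → ((V.withTree a q).Accepts π x w ↔
      passes (treeBits π) (V.leaf π x (2 ^ (r + 3))) [] true 0
          (-(treeBits π r 0 []).toNat) w = true ∧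
        (a : ℤ) * 2 ^ r ≤ q * claim (treeBits π) [] r) := by
    rintro w hw
    rw [← hw]
    exact accepts_withTree_iff V π x hq (by rintro rfl; simp at hw; omega)
  -- The comparison of the root with the threshold does not depend on the coins. If it fails,
  -- nothing is accepted; if it holds, `claim_add_le` at the root forces many walks to fail.
  by_cases hclaim : (a : ℤ) * 2 ^ r ≤ q * claim (treeBits π) [] r
  · have h₁ := claim_add_le (β := treeBits π) (V.leaf π x (2 ^ (r + 3))) [] true 0 r
      (-(treeBits π r 0 []).toNat) 0 (Or.inl rfl)
    have h₂ := h fun i => π (i + 2 ^ (r + 3))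
    rw [acceptProb_eq, div_le_iff₀ (by positivity)] at h₂
    have h₃ : countWords (fun w => Decidable.decide ((V.withTree a q).Accepts π x w)) r ≤
        countWords (passes (treeBits π) (V.leaf π x (2 ^ (r + 3))) [] true 0
          (-(treeBits π r 0 []).toNat)) r :=
      countWords.mono fun w hw hw' => ((hacc w hw).mp (by simpa using hw')).1
    have h₄ : (countWords (fun w => Decidable.decide ((V.withTree a q).Accepts π x w)) r : ℝ) ≤
        countWords (passes (treeBits π) (V.leaf π x (2 ^ (r + 3))) [] true 0
          (-(treeBits π r 0 []).toNat)) r := by exact_mod_cast h₃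
    have h₅ : (claim (treeBits π) [] r : ℝ) ≤
        countWords (fun w => Decidable.decide (V.Accepts (fun i => π (i + 2 ^ (r + 3))) x w)) r +
          6 * (2 ^ r - countWords (passes (treeBits π) (V.leaf π x (2 ^ (r + 3))) [] true 0
            (-(treeBits π r 0 []).toNat)) r) := by
      simp only [List.replicate_zero, List.append_nil, add_zero, leaf,
        List.reverse_reverse] at h₁
      exact_mod_cast h₁
    have h₆ : (a : ℝ) * 2 ^ r ≤ q * claim (treeBits π) [] r := by exact_mod_cast hclaim
    have h₇ : (a / q : ℝ) * 2 ^ r ≤ claim (treeBits π) [] r := by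
      rw [div_mul_eq_mul_div, div_le_iff₀ hq']
      linarith
    linarith
  · rw [countWords.eq_zero fun w hw => by simp [hacc w hw, hclaim]]
    have : 0 ≤ 1 - (a / q - s) / 6 := by
      have := h π
      have : (0 : ℝ) ≤ V.acceptProb π x := by unfold acceptProb; positivity
      linarith
    simpa using mul_nonneg this hpow.le

/-- The completeness of the verifier. -/
theorem exists_acceptProb_withTree_eq_one (hq : 0 < q) (ha : 0 < a)
    (h : (a / q : ℝ) ≤ V.acceptProb π x) :
    ∃ π', (V.withTree a q).acceptProb π' x = 1 := by
  classical
  set r := V.coins x with hr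
  have hpow : (0 : ℝ) < 2 ^ r := by positivity
  have hq' : (0 : ℝ) < q := by exact_mod_cast hq
  set ver : List Bool → Bool := fun L => Decidable.decide (V.Accepts π x L.reverse) with hver
  -- The true counts, followed by the old proof. The definition by an existential is unambiguous
  -- because addresses are injective.
  set π' : ℕ → Bool := fun i =>
    if i < 2 ^ (r + 3) then Decidable.decide (∃ m j S, i = ofBits (address m j S) ∧
      (leafCount ver S (m + j)).testBit m = true)
    else π (i - 2 ^ (r + 3)) with hπ'
  have hshift : (fun i => π' (i + 2 ^ (r + 3))) = π := by
    funext i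
    simp [hπ']
  have hleaf : V.leaf π' x (2 ^ (r + 3)) = ver := by
    unfold leaf
    rw [hshift]
  have honest : Honest (treeBits π') ver r := by
    intro m j S hm
    have hlt := ofBits_lt (address m j S)
    rw [length_address, hm] at hlt
    rw [treeBits, hπ']
    dsimp only
    rw [if_pos hlt, Bool.eq_iff_iff, decide_eq_true_eq]
    constructor
    · rintro ⟨m', j', S', h₁, h₂⟩
      obtain ⟨rfl, rfl, rfl⟩ := ofBits_address_injective h₁
      exact h₂
    · exact fun h => ⟨m, j, S, rfl, h⟩
  refine ⟨π', ?_⟩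
  -- Without coins the acceptance probability is 0 or 1, and it is positive because `0 < a`.
  rcases Nat.eq_zero_or_pos r with h0 | h0
  · rw [acceptProb_withTree_of_coins_eq_zero V π' x h0]
    rw [h0] at hshift
    rw [hshift]
    rw [acceptProb_eq, ← hr, h0] at h ⊢
    have h₁ : (0 : ℝ) < a / q := div_pos (by exact_mod_cast ha) hq'
    have h₂ := countWords.le_pow (fun w => Decidable.decide (V.Accepts π x w)) 0
    rw [pow_zero, div_one] at h ⊢
    have h₃ : 0 < countWords (fun w => Decidable.decide (V.Accepts π x w)) 0 := by
      exact_mod_cast h₁.trans_le h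
    exact_mod_cast le_antisymm h₂ h₃
  have hcount : (claim (treeBits π') [] r : ℝ) =
      countWords (fun w => Decidable.decide (V.Accepts π x w)) r := by
    rw [honest.claim_eq [] r (by simp)]
    simp [leafCount, hver]
  rw [acceptProb_eq, countWords.eq_pow]
  · change ((2 ^ r : ℕ) : ℝ) / 2 ^ r = 1
    simp
  · intro w hw
    change w.length = r at hw
    rw [decide_eq_true_eq, accepts_withTree_iff V π' x hq (by rintro rfl; simp at hw; omega), hw,
      hleaf]
    -- The difference at the root, as a test that has read only its top bit sees it, is zero: the
    -- counts of the two children add up to that of the root.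
    refine ⟨honest.passes [] true 0 _ w (by simpa using hw) ?_, ?_⟩
    · rw [hw]
      obtain ⟨k, hk⟩ : ∃ k, r = k + 1 := ⟨r - 1, by omega⟩
      have h₁ := honest.claim_eq [] r (by simp)
      have h₂ := honest.claim_eq [true] k (by simp; omega)
      have h₃ := honest.claim_eq [false] k (by simp; omega)
      have h₄ := leafCount_succ ver [] k true
      rw [hk] at h₁ ⊢
      rw [h₄] at h₁
      simp only [claim, lowBits, tail, Bool.not_true] at *
      push_cast at *
      linarith
    · rw [acceptProb_eq, div_le_div_iff₀ hq' hpow, ← hcount] at h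
      rw [mul_comm (q : ℤ)]
      exact_mod_cast h

end Verifier

/-! ### The main theorem -/

theorem theorem1 (c s : ℝ) (hs : 0 < s) (hsc : s < c) (hc : c < 1) :
    ∃ s' : ℝ, 0 < s' ∧ s' < 1 ∧ ∃ C : ℕ, ∀ r q : ℕ → ℕ,
      PCP (fun _ => c) (fun _ => s) r q ⊆
          PCP (fun _ => 1) (fun _ => s') r (fun n => q n + C * r n) ∧
        ∀ ℓ : ℕ → ℕ,
          PCPWithLength (fun _ => c) (fun _ => s) r q ℓ ⊆
            PCPWithLength (fun _ => 1) (fun _ => s') r (fun n => q n + C * r n)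
              (fun n => ℓ n + C * 2 ^ r n) := by
  -- A rational threshold makes the comparison at the root one of integers, with the excess
  -- saturated to a finite range.
  obtain ⟨t, hst, htc⟩ := exists_rat_btwn hsc
  have ht : 0 < t := by exact_mod_cast hs.trans hst
  have e : ((t.num.toNat : ℝ) / t.den) = t := by
    have : ((t.num.toNat : ℤ) : ℝ) = t.num := by
      rw [Int.toNat_of_nonneg (Rat.num_pos.mpr ht).le]
    rw [Rat.cast_def, ← this, Int.cast_natCast]
  have key : ∀ (V : Verifier) (L : Language Bool), V.Verifies (fun _ => c) (fun _ => s) L →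
      (V.withTree t.num.toNat t.den).Verifies (fun _ => 1) (fun _ => 1 - (t - s) / 6) L := by
    rintro V L ⟨h₁, h₂⟩
    refine ⟨fun x hx => ?_, fun x hx π => ?_⟩
    · obtain ⟨π, hπ⟩ := h₁ x hx
      obtain ⟨π', hπ'⟩ := V.exists_acceptProb_withTree_eq_one (a := t.num.toNat) π x
        t.den_pos (by have := Rat.num_pos.mpr ht; omega) (by rw [e]; exact htc.le.trans hπ)
      exact ⟨π', hπ'.ge⟩
    · have := V.acceptProb_withTree_le π x t.den_pos (by rw [e]; exact hst)
        (by rw [e]; exact htc.trans hc) (h₂ x hx)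
      rwa [e] at this
  -- The constant 8 comes from the `2 ^ (r + 3)` positions reserved for the tree; the queries alone
  -- would need only 6.
  refine ⟨1 - (t - s) / 6, by linarith, by linarith, 8, fun r q => ⟨?_, fun ℓ => ?_⟩⟩
  · rintro L ⟨V, hV, h⟩
    exact ⟨_, hV.withTree _ _, key V L h⟩
  · rintro L ⟨V, hV, hℓ, h⟩
    exact ⟨_, hV.withTree _ _, hℓ.withTree hV _ _, key V L h⟩
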